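/- **Terms.** $\lambda$-terms are built from a countably infinite set of variables $\mathcal V$; $(v)u$ denotes application, and a term is normal if it contains no subterm $(\lambda x.t)u$. A term respects the variable convention if every variable is bound at most once in it. **Machines.** A closure is a pair $(t,e)$ of a term $t$ and an environment $e$, i.e. a partial map with finite domain from variables to closures (of finite nesting depth). It denotes the term $\overline{(t,e)}$, obtained by capture-avoiding substitution of $\overline{e(x)}$ for every $x\in\mathrm{dom}(e)$ in $t$. A state is a non-empty finite sequence (stack) $c.\pi$ of closures; $\epsilon$ is the empty stack. Configurations are states, abstractions $\lambda y.k$ with $k$ a configuration, and head terms $(x)t_1\dots t_p$ with $x$ a variable and every $t_i$ a $\lambda$-term or a configuration. The steps of the *head machine* $\succ_h$ are: 1. $(x,e).\pi\succ e(x).\pi$ if $x\in\mathrm{dom}(e)$; 2. $(\lambda x.t,e).(c.\pi)\succ(t,\{(x,c)\}\cup e).\pi$; 3. $((s)t,e).\pi\succ(s,e).((t,e).\pi)$; 4. $(\lambda x.t,e).\epsilon\succ\lambda x.((t,e).\epsilon)$; 5. $((x,e),c_1,\dots,c_q)\succ(x)\overline{c_1}\dots\overline{c_q}$ if $x\notin\mathrm{dom}(e)$;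 6. $\lambda y.k\succ\lambda y.k'$ if $k\succ k'$; and head terms make no step. The *normalizing machine* $\succ_\beta$ has rules 1, 2, 3, 4, 6; instead of rule 5, $((x,e),c_1,\dots,c_q)\succ(x)(c_1.\epsilon)\dots(c_q.\epsilon)$ if $x\notin\mathrm{dom}(e)$; and on head terms, $(k)t\succ(k')t$ if $k\succ k'$, and $(k)t\succ(k)t'$ if $k$ makes no step and $t\succ t'$. Both machines are deterministic. $l_h(k)$ and $l_\beta(k)$ in $\mathbb N\cup\{\infty\}$ are the numbers of steps made by the head machine and by the normalizing machine from $k$ until no step is possible ($\infty$ if this never happens). Since the machines operate on states that respect the variable convention, $l((t,\emptyset).\epsilon)$ is computed on any $\alpha$-equivalent representative of $t$ that respects it. **Points.** Let $A$ be a set of atoms and $D$ the least set with $D=A\,\dot\cup\,(\mathcal M_{\mathrm{fin}}(D)\times D)$, where $\mathcal M_{\mathrm{fin}}(X)$ is the set of finite multisets over $X$. Define $|\cdot|$ and $\mathrm{aux}$ on $D$ by $|\gamma|=1$ and $\mathrm{aux}(\gamma)=0$ for $\gamma\in A$, and, for $\alpha=([\alpha_1,\dots,\alpha_n],\alpha_0)$,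 $|\alpha|=\sum_i\mathrm{aux}(\alpha_i)+|\alpha_0|+1$ and $\mathrm{aux}(\alpha)=\sum_i|\alpha_i|+\mathrm{aux}(\alpha_0)+1$. For $a=[\alpha_1,\dots,\alpha_n]$ put $|a|=\sum_i|\alpha_i|$. Let $D^{\mathrm{ex}},\overline{D^{\mathrm{ex}}}\subseteq D$ be the least sets with $D^{\mathrm{ex}}=A\cup(\mathcal M_{\mathrm{fin}}(\overline{D^{\mathrm{ex}}})\times D^{\mathrm{ex}})$ and $\overline{D^{\mathrm{ex}}}=A\cup((\mathcal M_{\mathrm{fin}}(D^{\mathrm{ex}})\setminus\{[]\})\times\overline{D^{\mathrm{ex}}})$. A substitution is a map $\sigma:D\to D$ with $\sigma([\alpha_1,\dots,\alpha_n],\alpha)=([\sigma(\alpha_1),\dots,\sigma(\alpha_n)],\sigma(\alpha))$; put $\overline\sigma([\alpha_1,\dots,\alpha_n])=[\sigma(\alpha_1),\dots,\sigma(\alpha_n)]$. **Semantics.** For distinct variables $\vec x=(x_1,\dots,x_m)$ containing the free variables of $t$, the set $\llbracket t\rrbracket_{\vec x}\subseteq\mathcal M_{\mathrm{fin}}(D)^m\times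 D$ is defined by induction on $t$: $\llbracket x_j\rrbracket_{\vec x}$ is the set of the $(([],\dots,[\alpha],\dots,[]),\alpha)$, with $[\alpha]$ in position $j$; $\llbracket\lambda x.t\rrbracket_{\vec x}=\{(\vec a,(a,\alpha)) : ((\vec a,a),\alpha)\in\llbracket t\rrbracket_{\vec x,x}\}$; and $\llbracket(s)t\rrbracket_{\vec x}$ is the set of the $(\sum_{i=0}^n\vec a^{\,i},\alpha)$ such that, for some $\alpha_1,\dots,\alpha_n$, $(\vec a^{\,0},([\alpha_1,\dots,\alpha_n],\alpha))\in\llbracket s\rrbracket_{\vec x}$ and $(\vec a^{\,i},\alpha_i)\in\llbracket t\rrbracket_{\vec x}$ for $1\le i\le n$. For closed $t$, $\llbracket t\rrbracket\subseteq D$ is the case $m=0$. For $X,Y\subseteq D$ let $$\mathcal U(X,Y)=\{((a,\alpha),a')\in(X\setminus A)\times\mathcal M_{\mathrm{fin}}(Y) : \overline\sigma(a)=\overline\sigma(a')\text{ for some substitution }\sigma\},$$ $$\mathcal U^{\mathrm{ex}}(X,Y)=\{((a,\alpha),a')\in(X\setminus A)\times\mathcal M_{\mathrm{fin}}(Y)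 : \overline\sigma(a)=\overline\sigma(a')\text{ and }\sigma(\alpha)\in D^{\mathrm{ex}}\text{ for some substitution }\sigma\}.$$ **Theorem.** Assume that $A$ is infinite. For any two closed normal $\lambda$-terms $u$ and $v$ (with $\inf\emptyset=\infty$), 1. $l_h(((v)u,\emptyset).\epsilon)=\inf\{|(a,\alpha)|+|a'|+1 : ((a,\alpha),a')\in\mathcal U(\llbracket v\rrbracket,\llbracket u\rrbracket)\}$; 2. $l_\beta(((v)u,\emptyset).\epsilon)=\inf\{|(a,\alpha)|+|a'|+1 : ((a,\alpha),a')\in\mathcal U^{\mathrm{ex}}(\llbracket v\rrbracket,\llbracket u\rrbracket)\}$. -/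

import Mathlib

universe uu

namespace Krivine

/-! ## Lambda-terms -/

/-- The (countably infinite) set of variables. -/
abbrev Var : Type := ℕ

/-- Raw lambda-terms with named variables. `app v u` is the term `(v)u`. -/
inductive Term : Type
  | var (x : Var) : Term
  | lam (x : Var) (t : Term) : Term
  | app (v u : Term) : Term

namespace Term

/-- The free variables of a term. -/
def fv : Term → Finset Var
  | var x => {x}
  | lam x t => t.fv.erase x
  | app v u => v.fv ∪ u.fv

/-- A term is closed if it has no free variable. -/
def Closed (t : Term) : Prop := t.fv = ∅

/-- The list of all the binding occurrences of variables in a term, with repetitions. -/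
def binders : Term → List Var
  | var _ => []
  | lam x t => x :: t.binders
  | app v u => v.binders ++ u.binders

/-- The variable convention: every variable is bound at most once. -/
def RespectsVC (t : Term) : Prop := t.binders.Nodup

/-- `t` is an abstraction. -/
def IsLam (t : Term) : Prop := ∃ x u, t = lam x u

/-- A term is normal if it has no subterm of the form `(λx.t)u`. -/
def Normal : Term → Prop
  | var _ => True
  | lam _ t => t.Normal
  | app v u => ¬ v.IsLam ∧ v.Normal ∧ u.Normal

/-- Two occurrences of variables, under the two sequences of binders given by the first and second
components of the list (innermost binder first), refer to the same binder, or are both free and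
equal. -/
def AlphaVar : List (Var × Var) → Var → Var → Prop
  | [], x, y => x = y
  | (a, b) :: l, x, y => (x = a ∧ y = b) ∨ (x ≠ a ∧ y ≠ b ∧ AlphaVar l x y)

/-- Alpha-equivalence of two terms placed under two sequences of binders. -/
def AlphaUnder : List (Var × Var) → Term → Term → Prop
  | l, var x, var y => AlphaVar l x y
  | l, lam x t, lam y u => AlphaUnder ((x, y) :: l) t u
  | l, app v u, app v' u' => AlphaUnder l v v' ∧ AlphaUnder l u u'
  | _, _, _ => False

/-- Alpha-equivalence: equality up to the names of bound variables. -/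
def AlphaEq (t u : Term) : Prop := AlphaUnder [] t u

/-- Simultaneous capture-avoiding substitution. A binder is renamed only when its name
is free in one of the terms substituted below it. -/
def subst : Term → (Var → Term) → Term
  | var x, σ => σ x
  | app v u, σ => app (v.subst σ) (u.subst σ)
  | lam x t, σ =>
    let S : Finset Var := (t.fv.erase x).biUnion fun z => (σ z).fv
    let y : Var := if x ∈ S then S.sup id + 1 else x
    lam y (t.subst (Function.update σ x (var y)))

end Term

/-! ## Closures and states -/

/-- A closure `(t, e)`: a term together with an environment `e`, that is, a partial map with finite
domain `dom` from variables to closures. -/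
inductive Closure : Type
  | mk (t : Term) (dom : Finset Var) (e : {x // x ∈ dom} → Closure) : Closure

/-- The closure `(t, ∅)`. -/
def Closure.ofTerm (t : Term) : Closure := .mk t ∅ fun x => absurd x.2 (Finset.notMem_empty x.1)

/-- The closure `(t, {(x, c)} ∪ e)`. -/
def Closure.extend (t : Term) (x : Var) (c : Closure) (dom : Finset Var)
    (e : {x // x ∈ dom} → Closure) : Closure :=
  .mk t (insert x dom) fun y =>
    if h : y.1 = x then c else e ⟨y.1, Finset.mem_of_mem_insert_of_ne y.2 h⟩

/-- The term `t[e]` denoted by the closure `(t, e)`. -/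
def Closure.toTerm : Closure → Term
  | .mk t dom e => t.subst fun x => if h : x ∈ dom then (e ⟨x, h⟩).toTerm else .var x

/-- A state: a non-empty stack of closures, `top . rest`. -/
structure State : Type where
  top : Closure
  rest : List Closure

/-- The state `(t, ∅) . ε`. -/
def State.ofTerm (t : Term) : State := ⟨Closure.ofTerm t, []⟩

/-- The transition (a partial map) of states. -/
def State.step : State → Option State
  | ⟨.mk (.var x) dom e, π⟩ => if h : x ∈ dom then some ⟨e ⟨x, h⟩, π⟩ else none
  | ⟨.mk (.lam x u) dom e, c :: π⟩ => some ⟨Closure.extend u x c dom e, π⟩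
  | ⟨.mk (.lam _ _) _ _, []⟩ => none
  | ⟨.mk (.app v u) dom e, π⟩ => some ⟨.mk v dom e, .mk u dom e :: π⟩

/-! ## The two machines -/

mutual

/-- Terms `(x)t₁…tₚ` where each `tᵢ` is a lambda-term or a configuration. -/
inductive HeadTerm : Type
  | var (x : Var) : HeadTerm
  | appTerm (v : HeadTerm) (t : Term) : HeadTerm
  | appConf (v : HeadTerm) (k : Conf) : HeadTerm

/-- The configurations on which the machines operate: states, head terms, and abstractions of
configurations. -/
inductive Conf : Type
  | state (s : State) : Conf
  | head (h : HeadTerm) : Conf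
  | lam (y : Var) (k : Conf) : Conf

end

/-- The transition (a partial map) of the machine computing the principal head normal form. -/
def headStep : Conf → Option Conf
  | .state s =>
    match s.step with
    | some s' => some (.state s')
    | none =>
      match s with
      | ⟨.mk (.var x) _ _, cs⟩ =>
        some (.head (cs.foldl (fun h c => .appTerm h c.toTerm) (.var x)))
      | ⟨.mk (.lam x u) dom e, _⟩ => some (.lam x (.state ⟨.mk u dom e, []⟩))
      | ⟨.mk (.app _ _) _ _, _⟩ => none
  | .head _ => none
  | .lam y k => (headStep k).map (.lam y)

mutual

/-- The transition of the normalizing machine on head terms: the arguments of the head variable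
are reduced from left to right. -/
def betaStepHead : HeadTerm → Option HeadTerm
  | .var _ => none
  | .appTerm v t => (betaStepHead v).map fun v' => .appTerm v' t
  | .appConf v k =>
    match betaStepHead v with
    | some v' => some (.appConf v' k)
    | none => (betaStep k).map fun k' => .appConf v k'

/-- The transition (a partial map) of the machine computing the beta-normal form. -/
def betaStep : Conf → Option Conf
  | .state s =>
    match s.step with
    | some s' => some (.state s')
    | none =>
      match s with
      | ⟨.mk (.var x) _ _, cs⟩ =>
        some (.head (cs.foldl (fun h c => .appConf h (.state ⟨c, []⟩)) (.var x)))
      | ⟨.mk (.lam x u) dom e, _⟩ => some (.lam x (.state ⟨.mk u dom e, []⟩))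
      | ⟨.mk (.app _ _) _ _, _⟩ => none
  | .head h => (betaStepHead h).map .head
  | .lam y k => (betaStep k).map (.lam y)

end

/-- From `k`, the partial map `step` can be iterated exactly `n` times. -/
def HaltsIn {K : Type} (step : K → Option K) : ℕ → K → Prop
  | 0, k => step k = none
  | n + 1, k => ∃ k', step k = some k' ∧ HaltsIn step n k'

/-- The number of steps of the execution from `k`; it is infinite if the execution does not
terminate. -/
noncomputable def runLength {K : Type} (step : K → Option K) (k : K) : ℕ∞ :=
  ⨅ (n : ℕ) (_ : HaltsIn step n k), (n : ℕ∞)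

/-- The number of steps of the head machine. -/
noncomputable def lHead (k : Conf) : ℕ∞ := runLength headStep k

/-- The number of steps of the normalizing machine. -/
noncomputable def lBeta (k : Conf) : ℕ∞ := runLength betaStep k

/-! ## The relational model: `D = A ⊔ (finite multisets over D) × D` -/

/-- The functor `X ↦ A ⊔ (finite multisets over X) × X`. -/
def DF (A : Type uu) (X : Type uu) : Type uu := A ⊕ (Multiset X × X)

instance (A : Type uu) : Functor (DF A) where
  map f := Sum.map id (Prod.map (Multiset.map f) f)

/-- The functor `DF A` is a quotient of the polynomial functor whose shapes are the atoms (with no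
position) and the natural numbers `n` (with `n + 1` positions). -/
noncomputable instance (A : Type uu) : QPF (DF A) where
  P := ⟨A ⊕ ℕ, fun s => s.elim (fun _ => PEmpty) (fun n => ULift.{uu} (Option (Fin n)))⟩
  abs {_} p :=
    match p with
    | ⟨.inl a, _⟩ => .inl a
    | ⟨.inr _, f⟩ => .inr (Finset.univ.val.map (fun i => f ⟨some i⟩), f ⟨none⟩)
  repr {_} x :=
    match x with
    | .inl a => ⟨.inl a, fun e => e.elim⟩
    | .inr (m, y) => ⟨.inr m.toList.length, fun o => o.down.elim y m.toList.get⟩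
  abs_repr x := by
    rcases x with a | ⟨m, y⟩
    · rfl
    · change Sum.inr (Multiset.map m.toList.get Finset.univ.val, y) = _
      have h : Multiset.map m.toList.get Finset.univ.val = m := by
        rw [Fin.univ_val_map, List.ofFn_get, Multiset.coe_toList]
      rw [h]
  abs_map f p := by
    rcases p with ⟨a | n, g⟩
    · rfl
    · change Sum.inr _ = Sum.inr (Multiset.map f _, _)
      rw [Multiset.map_map]
      rfl

/-- The set `D` of points over a set `A` of atoms, the least solution of
`D = A ⊔ (finite multisets over D) × D`. -/
def D (A : Type uu) : Type uu := QPF.Fix (DF A)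

namespace D

variable {A : Type uu}

/-- An atom, seen as a point. -/
noncomputable def atom (a : A) : D A := QPF.Fix.mk (F := DF A) (.inl a)

/-- The point `(m, α)`. -/
noncomputable def arrow (m : Multiset (D A)) (α : D A) : D A :=
  QPF.Fix.mk (F := DF A) (.inr (m, α))

theorem atom_injective : Function.Injective (atom : A → D A) := by
  intro a b h
  have h' : (Sum.inl a : A ⊕ (Multiset (D A) × D A)) = Sum.inl b :=
    (QPF.Fix.dest_mk (F := DF A) (.inl a)).symm.trans
      ((congrArg (QPF.Fix.dest (F := DF A)) h).trans (QPF.Fix.dest_mk (F := DF A) (.inl b)))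
  exact Sum.inl.inj h'

theorem arrow_inj {m m' : Multiset (D A)} {α α' : D A} (h : arrow m α = arrow m' α') :
    m = m' ∧ α = α' := by
  have h' : (Sum.inr (m, α) : A ⊕ (Multiset (D A) × D A)) = Sum.inr (m', α') :=
    (QPF.Fix.dest_mk (F := DF A) (.inr (m, α))).symm.trans
      ((congrArg (QPF.Fix.dest (F := DF A)) h).trans
        (QPF.Fix.dest_mk (F := DF A) (.inr (m', α'))))
  exact Prod.mk.inj (Sum.inr.inj h')

theorem atom_ne_arrow (a : A) (m : Multiset (D A)) (α : D A) : atom a ≠ arrow m α := by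
  intro h
  have h' : (Sum.inl a : A ⊕ (Multiset (D A) × D A)) = Sum.inr (m, α) :=
    (QPF.Fix.dest_mk (F := DF A) (.inl a)).symm.trans
      ((congrArg (QPF.Fix.dest (F := DF A)) h).trans (QPF.Fix.dest_mk (F := DF A) (.inr (m, α))))
  cases h'

theorem induction {p : D A → Prop} (hatom : ∀ a, p (atom a))
    (harrow : ∀ m α, (∀ β ∈ m, p β) → p α → p (arrow m α)) (α : D A) : p α := by
  refine QPF.Fix.ind (F := DF A) p ?_ α
  rintro x ⟨y, rfl⟩
  rcases y with a | ⟨m, β⟩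
  · exact hatom a
  · refine harrow (m.map Subtype.val) β.1 ?_ β.2
    intro γ hγ
    obtain ⟨δ, -, rfl⟩ := Multiset.mem_map.1 hγ
    exact δ.2

/-- The recursion step for the pair `(|α|, aux α)`. -/
def sizesStep : DF A (ULift.{uu} (ℕ × ℕ)) → ULift.{uu} (ℕ × ℕ)
  | .inl _ => ⟨(1, 0)⟩
  | .inr (m, y) =>
    ⟨((m.map fun z => z.down.2).sum + y.down.1 + 1, (m.map fun z => z.down.1).sum + y.down.2 + 1)⟩

/-- The pair `(|α|, aux α)`, by recursion on `α`; the four equations below characterize it. -/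
noncomputable def sizes (α : D A) : ℕ × ℕ := (QPF.Fix.rec (F := DF A) sizesStep α).down

/-- The size `|α|`. -/
noncomputable def size (α : D A) : ℕ := (sizes α).1

/-- The auxiliary size `aux α`. -/
noncomputable def aux (α : D A) : ℕ := (sizes α).2

theorem sizes_atom (a : A) : sizes (atom a) = (1, 0) :=
  congrArg ULift.down (QPF.Fix.rec_eq (F := DF A) sizesStep (.inl a))

theorem sizes_arrow (m : Multiset (D A)) (α : D A) :
    sizes (arrow m α) = ((m.map aux).sum + size α + 1, (m.map size).sum + aux α + 1) := by
  refine (congrArg ULift.down (QPF.Fix.rec_eq (F := DF A) sizesStep (.inr (m, α)))).trans ?_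
  let r : D A → ULift.{uu} (ℕ × ℕ) := QPF.Fix.rec (F := DF A) sizesStep
  change (((m.map r).map fun z => z.down.2).sum + (r α).down.1 + 1,
    ((m.map r).map fun z => z.down.1).sum + (r α).down.2 + 1) = _
  rw [Multiset.map_map, Multiset.map_map]
  rfl

theorem size_atom (a : A) : size (atom a) = 1 := congrArg Prod.fst (sizes_atom a)

theorem aux_atom (a : A) : aux (atom a) = 0 := congrArg Prod.snd (sizes_atom a)

theorem size_arrow (m : Multiset (D A)) (α : D A) :
    size (arrow m α) = (m.map aux).sum + size α + 1 := congrArg Prod.fst (sizes_arrow m α)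

theorem aux_arrow (m : Multiset (D A)) (α : D A) :
    aux (arrow m α) = (m.map size).sum + aux α + 1 := congrArg Prod.snd (sizes_arrow m α)

/-- The size `|a|` of a finite multiset of points. -/
noncomputable def msize (a : Multiset (D A)) : ℕ := (a.map size).sum

mutual

/-- The points in which the empty multiset has no positive occurrence. -/
inductive IsEx : D A → Prop
  | atom (a : A) : IsEx (atom a)
  | arrow (m : Multiset (D A)) (α : D A) :
      (∀ β ∈ m, IsExBar β) → IsEx α → IsEx (arrow m α)

/-- The points in which the empty multiset has no negative occurrence. -/
inductive IsExBar : D A → Prop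
  | atom (a : A) : IsExBar (atom a)
  | arrow (m : Multiset (D A)) (α : D A) :
      m ≠ 0 → (∀ β ∈ m, IsEx β) → IsExBar α → IsExBar (arrow m α)

end

/-- Substitutions: the maps `D → D` that commute with the formation of arrows. -/
def IsSubstitution (σ : D A → D A) : Prop :=
  ∀ (m : Multiset (D A)) (α : D A), σ (arrow m α) = arrow (m.map σ) (σ α)

end D

/-! ## Interpretation of terms -/

/-- The interpretation `⟦t⟧_{x₁,…,xₘ}`, a set of pairs `((a₁,…,aₘ), α)`. The `xᵢ` are meant to be
distinct; if raw terms make a name occur twice, its last occurrence, that is, the innermost binder,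
is the relevant one, so that the interpretation is invariant under alpha-equivalence. -/
def interp (A : Type uu) :
    Term → (m : ℕ) → (Fin m → Var) → Set ((Fin m → Multiset (D A)) × D A)
  | .var x, _, xs =>
    {p | ∃ j, xs j = x ∧ (∀ k, j < k → xs k ≠ x) ∧ p.1 = Pi.single j {p.2}}
  | .lam x u, m, xs =>
    {p | ∃ a α, p.2 = D.arrow a α ∧
      ((Fin.snoc p.1 a : Fin (m + 1) → Multiset (D A)), α) ∈
        interp A u (m + 1) (Fin.snoc xs x : Fin (m + 1) → Var)}
  | .app v u, m, xs =>
    {p | ∃ (n : ℕ) (β : Fin n → D A) (a₀ : Fin m → Multiset (D A))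
      (a : Fin n → Fin m → Multiset (D A)),
      p.1 = a₀ + ∑ i, a i ∧
      (a₀, D.arrow (Finset.univ.val.map β) p.2) ∈ interp A v m xs ∧
      ∀ i, (a i, β i) ∈ interp A u m xs}

/-- The interpretation `⟦t⟧ ⊆ D` of a closed term. -/
def sem (A : Type uu) (t : Term) : Set (D A) :=
  {α | (Fin.elim0, α) ∈ interp A t 0 Fin.elim0}

/-- The set `𝒰(X, Y)` of the `((a, α), a')` such that `(a, α) ∈ X`, all the elements of `a'` are
in `Y`, and some substitution unifies `a` and `a'`. -/
def unif {A : Type uu} (X Y : Set (D A)) : Set ((Multiset (D A) × D A) × Multiset (D A)) :=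
  {p | D.arrow p.1.1 p.1.2 ∈ X ∧ (∀ β ∈ p.2, β ∈ Y) ∧
    ∃ σ : D A → D A, D.IsSubstitution σ ∧ p.1.1.map σ = p.2.map σ}

/-- The set `𝒰ᵉˣ(X, Y)`: the unifying substitution `σ` has, moreover, to satisfy
`σ(α) ∈ Dᵉˣ`. -/
def unifEx {A : Type uu} (X Y : Set (D A)) : Set ((Multiset (D A) × D A) × Multiset (D A)) :=
  {p | D.arrow p.1.1 p.1.2 ∈ X ∧ (∀ β ∈ p.2, β ∈ Y) ∧
    ∃ σ : D A → D A, D.IsSubstitution σ ∧ p.1.1.map σ = p.2.map σ ∧ D.IsEx (σ p.1.2)}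

/-- The number `|(a, α)| + |a'| + 1`. -/
noncomputable def weight {A : Type uu} (p : (Multiset (D A) × D A) × Multiset (D A)) : ℕ :=
  D.size (D.arrow p.1.1 p.1.2) + D.msize p.2 + 1

end Krivine

-- The relational model is a non-idempotent intersection type system. Points are types, and a point
-- of the interpretation is a judgement whose context lists one assumption per use of a variable
-- (`mem_interp_iff`). `Derives` adds to this the number of rules of the derivation. Closures,
-- stacks and states are typed in the same style, each use of a closure paying for its own
-- derivation.
--
-- Every transition of states removes exactly one rule, and typings can be traced both ways through
-- it (`State.hasType_iff_of_step`). Hence a typed state halts within the size of any of its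
-- derivations, and a run of length `n` can be read backwards as a derivation of size exactly `n`.
-- For the head machine every type is allowed: arguments of the head variable are never evaluated
-- and can be typed by the empty multiset. For the normalizing machine the state must have a type in
-- `D.IsEx`, with free variables typed in `D.IsExBar`, so each such argument is typed at least once.
-- In both cases the length of the run is the least size of an admissible derivation of `(v)u`.
--
-- It remains to compute sizes from types. For a normal term, a derivation of `α` in `Γ` has at most
-- `D.size α + auxCtx Γ` rules (`Derives.le_of_normal`), and each derivation is the image, under a
-- suitable substitution, of one of the same size attaining the bound (`Derives.exists_principal`).
-- Substitutions preserve the number of rules. So a unifiable pair gives a derivation of `(v)u` no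
-- larger than its weight, and a derivation of `(v)u` gives a unifiable pair whose weight is its
-- size (`runLength_eq_iInf`). Atoms must be infinite so that one substitution sends atoms onto all
-- points, which makes every derivation an instance of a principal one.

namespace Krivine

/-! ## Sums of weights over a multiset -/

/-- `p` is a sum of weights, one for each element of `b`, where `R x q` says that `q` is a possible
weight of `x`. -/
def MSum {X M : Type*} [AddCommMonoid M] (R : X → M → Prop) (b : Multiset X) (p : M) : Prop :=
  ∃ L : Multiset (X × M), L.map Prod.fst = b ∧ (∀ q ∈ L, R q.1 q.2) ∧ (L.map Prod.snd).sum = p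

namespace MSum

variable {X Y M : Type*} [AddCommMonoid M] {R R' : X → M → Prop}

theorem zero_iff {p : M} : MSum R 0 p ↔ p = 0 := by
  constructor
  · rintro ⟨L, hL, -, rfl⟩
    rw [Multiset.map_eq_zero] at hL
    simp [hL]
  · rintro rfl
    exact ⟨0, by simp⟩

theorem cons_iff {x : X} {b : Multiset X} {p : M} :
    MSum R (x ::ₘ b) p ↔ ∃ q r, R x q ∧ MSum R b r ∧ p = q + r := by
  classical
  constructor
  · rintro ⟨L, hL, hR, rfl⟩
    obtain ⟨y, hy, rfl, hb⟩ := (Multiset.map_eq_cons _ _ _ _).2 hL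
    refine ⟨y.2, ((L.erase y).map Prod.snd).sum, hR y hy,
      ⟨L.erase y, hb, fun q hq => hR q (Multiset.mem_of_mem_erase hq), rfl⟩, ?_⟩
    conv_lhs => rw [← Multiset.cons_erase hy]
    simp
  · rintro ⟨q, r, hx, ⟨L, rfl, hR, rfl⟩, rfl⟩
    exact ⟨(x, q) ::ₘ L, by simp, by simpa using ⟨hx, fun a b h => hR _ h⟩, by simp⟩

theorem singleton_iff {x : X} {p : M} : MSum R {x} p ↔ R x p := by
  rw [← Multiset.cons_zero, cons_iff]
  constructor
  · rintro ⟨q, r, h, hr, rfl⟩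
    rw [zero_iff.1 hr, add_zero]
    exact h
  · exact fun h => ⟨p, 0, h, zero_iff.2 rfl, (add_zero p).symm⟩

theorem add_iff {b c : Multiset X} {p : M} :
    MSum R (b + c) p ↔ ∃ q r, MSum R b q ∧ MSum R c r ∧ p = q + r := by
  induction b using Multiset.induction generalizing p with
  | empty => simp [zero_iff]
  | cons x b ih =>
    rw [Multiset.cons_add, cons_iff]
    constructor
    · rintro ⟨q, r, h, hr, rfl⟩
      obtain ⟨s, t, hs, ht, rfl⟩ := ih.1 hr
      exact ⟨q + s, t, cons_iff.2 ⟨q, s, h, hs, rfl⟩, ht, (add_assoc _ _ _).symm⟩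
    · rintro ⟨q, r, h, hr, rfl⟩
      obtain ⟨s, t, hs, ht, rfl⟩ := cons_iff.1 h
      exact ⟨s, t + r, hs, ih.2 ⟨t, r, ht, hr, rfl⟩, add_assoc _ _ _⟩

theorem map_iff {f : Y → X} {b : Multiset Y} {p : M} :
    MSum R (b.map f) p ↔ MSum (fun y => R (f y)) b p := by
  induction b using Multiset.induction generalizing p with
  | empty => simp [zero_iff]
  | cons x b ih => simp only [Multiset.map_cons, cons_iff, ih]

theorem congr {b : Multiset X} {p : M} (h : ∀ x ∈ b, ∀ q, R x q ↔ R' x q) :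
    MSum R b p ↔ MSum R' b p := by
  induction b using Multiset.induction generalizing p with
  | empty => simp [zero_iff]
  | cons x b ih =>
    simp only [cons_iff, h x (Multiset.mem_cons_self x b),
      ih fun y hy => h y (Multiset.mem_cons_of_mem hy)]

/-- Assumptions on variables outside the environment cost nothing; only the condition on their types
remains. -/
theorem null_iff {P : X → Prop} {b : Multiset X} {p : M} :
    MSum (fun x q => P x ∧ q = 0) b p ↔ (∀ x ∈ b, P x) ∧ p = 0 := by
  induction b using Multiset.induction generalizing p with
  | empty => simp [zero_iff]
  | cons x b ih =>
    simp only [cons_iff, ih, Multiset.forall_mem_cons]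
    constructor
    · rintro ⟨q, r, ⟨h, rfl⟩, ⟨h', rfl⟩, rfl⟩
      exact ⟨⟨h, h'⟩, add_zero 0⟩
    · rintro ⟨⟨h, h'⟩, rfl⟩
      exact ⟨0, 0, ⟨h, rfl⟩, ⟨h', rfl⟩, (add_zero 0).symm⟩

end MSum

/-! ## Sized typing derivations -/

variable {A : Type uu}

/-- Typing contexts: finite multisets of typed occurrences of variables. -/
abbrev Ctx (A : Type uu) : Type uu := Multiset (Var × D A)

/-- The multiset of the types of the occurrences of `x` in `Γ`. -/
def typesOf (Γ : Ctx A) (x : Var) : Multiset (D A) := (Γ.filter fun q => q.1 = x).map Prod.snd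

/-- The context `Γ` without the occurrences of `x`. -/
def without (Γ : Ctx A) (x : Var) : Ctx A := Γ.filter fun q => q.1 ≠ x

/-- `Derives t α (n, Γ)`: the judgement `Γ ⊢ t : α` has a derivation with `n` rules. -/
def Derives : Term → D A → ℕ × Ctx A → Prop
  | .var x, α, p => p = (1, {(x, α)})
  | .lam x t, γ, p => ∃ α q, Derives t α q ∧ γ = D.arrow (typesOf q.2 x) α ∧
      p = (q.1 + 1, without q.2 x)
  | .app v u, α, p => ∃ b q r, Derives v (D.arrow b α) q ∧ MSum (Derives u) b r ∧
      p = q + r + (1, 0)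

theorem typesOf_add (Γ Δ : Ctx A) (x : Var) :
    typesOf (Γ + Δ) x = typesOf Γ x + typesOf Δ x := by
  simp [typesOf]

theorem map_typesOf_add_without (Γ : Ctx A) (x : Var) :
    (typesOf Γ x).map (Prod.mk x) + without Γ x = Γ := by
  conv_rhs => rw [← Multiset.filter_add_not (fun q => q.1 = x) Γ]
  rw [typesOf, without, Multiset.map_map]
  congr 1
  conv_rhs => rw [← Multiset.map_id (Γ.filter fun q => q.1 = x)]
  refine Multiset.map_congr rfl ?_
  rintro ⟨y, α⟩ h
  have : y = x := (Multiset.mem_filter.1 h).2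
  simp [this]

theorem Derives.fst_pos {t : Term} {α : D A} {p : ℕ × Ctx A} (h : Derives t α p) : 0 < p.1 := by
  cases t with
  | var x => simp [Derives] at h; simp [h]
  | lam x t =>
    obtain ⟨β, q, -, -, rfl⟩ := h
    exact Nat.succ_pos _
  | app v u =>
    obtain ⟨b, q, r, -, -, rfl⟩ := h
    exact Nat.succ_pos _

theorem Derives.mem_fv {t : Term} {α : D A} {p : ℕ × Ctx A} (h : Derives t α p) :
    ∀ q ∈ p.2, q.1 ∈ t.fv := by
  induction t generalizing α p with
  | var x =>
    subst h
    simp [Term.fv]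
  | lam x t ih =>
    obtain ⟨β, q, hq, -, rfl⟩ := h
    intro y hy
    rw [without, Multiset.mem_filter] at hy
    exact Finset.mem_erase.2 ⟨hy.2, ih hq y hy.1⟩
  | app v u ihv ihu =>
    obtain ⟨b, q, r, hq, hr, rfl⟩ := h
    have key : ∀ y ∈ r.2, y.1 ∈ u.fv := by
      clear hq
      induction b using Multiset.induction generalizing r with
      | empty =>
        rw [MSum.zero_iff.1 hr]
        simp
      | cons β b ih =>
        obtain ⟨s, s', hs, hs', rfl⟩ := MSum.cons_iff.1 hr
        intro y hy
        rcases Multiset.mem_add.1 hy with hy | hy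
        · exact ihu hs y hy
        · exact ih _ hs' y hy
    intro y hy
    simp only [Prod.snd_add, add_zero, Multiset.mem_add] at hy
    rcases hy with hy | hy
    · exact Finset.mem_union_left _ (ihv hq y hy)
    · exact Finset.mem_union_right _ (key y hy)

theorem Derives.eq_zero_of_closed {t : Term} (ht : t.Closed) {α : D A} {p : ℕ × Ctx A}
    (h : Derives t α p) : p.2 = 0 :=
  Multiset.eq_zero_of_forall_notMem fun q hq => by
    simpa [show t.fv = ∅ from ht] using h.mem_fv q hq

/-! ## Invariance under alpha-equivalence -/

theorem Term.AlphaVar.symm {l : List (Var × Var)} {x y : Var} (h : AlphaVar l x y) :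
    AlphaVar (l.map Prod.swap) y x := by
  induction l with
  | nil => exact Eq.symm h
  | cons p l ih =>
    rcases h with ⟨h, h'⟩ | ⟨h, h', h''⟩
    · exact Or.inl ⟨h', h⟩
    · exact Or.inr ⟨h', h, ih h''⟩

theorem Term.AlphaUnder.symm {l : List (Var × Var)} {t u : Term} (h : AlphaUnder l t u) :
    AlphaUnder (l.map Prod.swap) u t := by
  induction t generalizing l u with
  | var x =>
    cases u with
    | var y => exact AlphaVar.symm h
    | lam y u => exact h.elim
    | app v u => exact h.elim
  | lam x t ih =>
    cases u with
    | var y => exact h.elim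
    | lam y u => exact ih h
    | app v u => exact h.elim
  | app v t ihv iht =>
    cases u with
    | var y => exact h.elim
    | lam y u => exact h.elim
    | app v' u => exact ⟨ihv h.1, iht h.2⟩

/-- The contexts `Γ` and `Δ` agree up to the renaming of variables described by `l`. -/
def AlphaCtx (l : List (Var × Var)) : Ctx A → Ctx A → Prop :=
  Multiset.Rel fun p q => Term.AlphaVar l p.1 q.1 ∧ p.2 = q.2

/-- Related occurrences are either both bound by the innermost pair of binders or both not, so the
matching of the contexts splits accordingly. -/
theorem AlphaCtx.cons {l : List (Var × Var)} {x y : Var} {Γ Δ : Ctx A}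
    (h : AlphaCtx ((x, y) :: l) Γ Δ) :
    typesOf Γ x = typesOf Δ y ∧ AlphaCtx l (without Γ x) (without Δ y) := by
  induction h with
  | zero => exact ⟨rfl, Multiset.Rel.zero⟩
  | @cons p q Γ Δ hpq _ ih =>
    obtain ⟨a, α⟩ := p
    obtain ⟨b, β⟩ := q
    obtain ⟨h, rfl : α = β⟩ := hpq
    rcases h with ⟨rfl, rfl⟩ | ⟨ha, hb, h⟩
    · simpa [typesOf, without] using ih
    · simp only [typesOf, without] at ih
      simp only [typesOf, without]
      rw [Multiset.filter_cons_of_neg _ (by exact ha), Multiset.filter_cons_of_neg _ (by exact hb),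
        Multiset.filter_cons_of_pos _ (by exact ha), Multiset.filter_cons_of_pos _ (by exact hb)]
      exact ⟨ih.1, Multiset.Rel.cons ⟨h, rfl⟩ ih.2⟩

/-- Derivations are renamed rule by rule, without changing their size or types. Only the names in
the context change, as prescribed by `l`. -/
theorem Derives.alphaUnder {l : List (Var × Var)} {t u : Term} (htu : t.AlphaUnder l u)
    {α : D A} {p : ℕ × Ctx A} (h : Derives t α p) :
    ∃ Δ, Derives u α (p.1, Δ) ∧ AlphaCtx l p.2 Δ := by
  induction t generalizing l u α p with
  | var x =>
    cases u with
    | var y =>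
      subst h
      refine ⟨{(y, α)}, rfl, ?_⟩
      exact Multiset.Rel.cons ⟨htu, rfl⟩ Multiset.Rel.zero
    | lam y u => exact htu.elim
    | app v u => exact htu.elim
  | lam x t ih =>
    cases u with
    | var y => exact htu.elim
    | lam y u =>
      obtain ⟨β, q, hq, rfl, rfl⟩ := h
      obtain ⟨Δ, hΔ, hl⟩ := ih htu hq
      exact ⟨_, ⟨β, _, hΔ, by rw [hl.cons.1], rfl⟩, hl.cons.2⟩
    | app v u => exact htu.elim
  | app v t ihv iht =>
    cases u with
    | var y => exact htu.elim
    | lam y u => exact htu.elim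
    | app v' u =>
      obtain ⟨b, q, r, hq, hr, rfl⟩ := h
      obtain ⟨Δ, hΔ, hl⟩ := ihv htu.1 hq
      have key : ∃ Δ', MSum (Derives u) b (r.1, Δ') ∧ AlphaCtx l r.2 Δ' := by
        clear hq hΔ
        induction b using Multiset.induction generalizing r with
        | empty =>
          rw [MSum.zero_iff.1 hr]
          exact ⟨0, MSum.zero_iff.2 rfl, Multiset.Rel.zero⟩
        | cons β b ih =>
          obtain ⟨s, s', hs, hs', rfl⟩ := MSum.cons_iff.1 hr
          obtain ⟨E, hE, hlE⟩ := iht htu.2 hs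
          obtain ⟨E', hE', hlE'⟩ := ih _ hs'
          exact ⟨E + E', MSum.cons_iff.2 ⟨_, _, hE, hE', rfl⟩, hlE.add hlE'⟩
      obtain ⟨Δ', hΔ', hl'⟩ := key
      exact ⟨Δ + Δ', ⟨b, _, _, hΔ, hΔ', by simp⟩, by simpa [AlphaCtx] using hl.add hl'⟩

theorem Derives.alphaEq {t u : Term} (htu : t.AlphaEq u) {α : D A} {p : ℕ × Ctx A}
    (h : Derives t α p) : Derives u α p := by
  obtain ⟨Δ, hΔ, hl⟩ := h.alphaUnder htu
  have : p.2 = Δ := by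
    rw [← Multiset.rel_eq]
    exact hl.mono fun a _ b _ h => Prod.ext h.1 h.2
  rw [← this] at hΔ
  exact hΔ

theorem derives_congr_alphaEq {t u : Term} (htu : t.AlphaEq u) {α : D A} {p : ℕ × Ctx A} :
    Derives t α p ↔ Derives u α p :=
  ⟨.alphaEq htu, .alphaEq (Term.AlphaUnder.symm htu)⟩

/-! ## Points of the model and typing derivations -/

/-- The position `j` is the last occurrence of `xs j` in `xs`. -/
def IsLast {m : ℕ} (xs : Fin m → Var) (j : Fin m) : Prop := ∀ k, j < k → xs k ≠ xs j

open Classical in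
/-- The tuple of multisets given by a context. -/
noncomputable def tuple {m : ℕ} (xs : Fin m → Var) (Γ : Ctx A) : Fin m → Multiset (D A) :=
  fun j => if IsLast xs j then typesOf Γ (xs j) else 0

/-- All the variables of `Γ` are in `xs`. -/
def Covers {m : ℕ} (xs : Fin m → Var) (Γ : Ctx A) : Prop := ∀ q ∈ Γ, ∃ j, xs j = q.1

theorem exists_isLast {m : ℕ} {xs : Fin m → Var} (j : Fin m) : ∃ k, xs k = xs j ∧ IsLast xs k := by
  classical
  obtain ⟨k, hk, hmax⟩ := (Finset.univ.filter fun k => xs k = xs j).exists_max_image id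
    ⟨j, by simp⟩
  simp only [Finset.mem_filter, Finset.mem_univ, true_and, id] at hk hmax
  exact ⟨k, hk, fun i hi h => (hmax i (h.trans hk)).not_gt hi⟩

theorem tuple_zero {m : ℕ} (xs : Fin m → Var) : tuple xs (0 : Ctx A) = 0 := by
  funext j
  simp [tuple, typesOf]

theorem tuple_add {m : ℕ} (xs : Fin m → Var) (Γ Δ : Ctx A) :
    tuple xs (Γ + Δ) = tuple xs Γ + tuple xs Δ := by
  funext j
  by_cases h : IsLast xs j <;> simp [tuple, h, typesOf_add]

theorem tuple_sum {m n : ℕ} (xs : Fin m → Var) (Δ : Fin n → Ctx A) :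
    tuple xs (∑ i, Δ i) = ∑ i, tuple xs (Δ i) :=
  map_sum (⟨⟨tuple xs, tuple_zero xs⟩, tuple_add xs⟩ : Ctx A →+ (Fin m → Multiset (D A))) Δ
    Finset.univ

theorem covers_add {m : ℕ} {xs : Fin m → Var} {Γ Δ : Ctx A} :
    Covers xs (Γ + Δ) ↔ Covers xs Γ ∧ Covers xs Δ := by
  simp only [Covers, Multiset.mem_add]
  exact ⟨fun h => ⟨fun q hq => h q (.inl hq), fun q hq => h q (.inr hq)⟩,
    fun h q hq => hq.elim (h.1 q) (h.2 q)⟩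

theorem tuple_singleton {m : ℕ} {xs : Fin m → Var} {j : Fin m} (hj : IsLast xs j) (α : D A) :
    tuple xs {(xs j, α)} = Pi.single j {α} := by
  funext k
  rcases eq_or_ne k j with rfl | hk
  · simp [tuple, hj, typesOf, Multiset.filter_singleton]
  · rw [Pi.single_eq_of_ne hk, tuple]
    split_ifs with h
    · have : xs j ≠ xs k := by
        rcases lt_or_gt_of_ne hk with h' | h'
        · exact h j h'
        · exact (hj k h').symm
      simp [typesOf, Multiset.filter_singleton, this]
    · rfl

/-- The new last position takes all the occurrences of `x`. An earlier position with the same name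
is shadowed and receives the empty multiset. -/
theorem tuple_snoc {m : ℕ} (xs : Fin m → Var) (x : Var) (Γ : Ctx A) :
    tuple (Fin.snoc xs x : Fin (m + 1) → Var) Γ =
      (Fin.snoc (tuple xs (without Γ x)) (typesOf Γ x) : Fin (m + 1) → Multiset (D A)) := by
  funext j
  refine Fin.lastCases ?_ (fun i => ?_) j
  · have : IsLast (Fin.snoc xs x : Fin (m + 1) → Var) (Fin.last m) :=
      fun k hk => absurd (Fin.le_last k) hk.not_ge
    simp [tuple, this]
  · have key : IsLast (Fin.snoc xs x : Fin (m + 1) → Var) i.castSucc ↔ x ≠ xs i ∧ IsLast xs i := by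
      constructor
      · intro h
        refine ⟨by simpa using h (Fin.last m) (Fin.castSucc_lt_last i), fun k hk => ?_⟩
        simpa using h k.castSucc (by simpa using hk)
      · rintro ⟨h, h'⟩ k
        refine Fin.lastCases (fun _ => by simpa using h) (fun k hk => ?_) k
        simpa using h' k (by simpa using hk)
    simp only [tuple, Fin.snoc_castSucc, typesOf, without, Multiset.filter_filter]
    by_cases h : x = xs i
    · rw [if_neg fun hl => (key.1 hl).1 h, Multiset.filter_eq_nil.2]
      · simp
      · rintro q - ⟨h1, h2⟩
        exact h2 (h1.trans h.symm)
    · have hf : Γ.filter (fun q => q.1 = xs i) = Γ.filter fun q => q.1 = xs i ∧ q.1 ≠ x :=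
        Multiset.filter_congr fun q _ => ⟨fun hq => ⟨hq, fun h' => h (h'.symm.trans hq)⟩, And.left⟩
      have key' : IsLast (Fin.snoc xs x : Fin (m + 1) → Var) i.castSucc ↔ IsLast xs i := by
        rw [key, and_iff_right h]
      rw [hf]
      split_ifs with h1 h2 h2
      · rfl
      · exact absurd (key'.1 h1) h2
      · exact absurd (key'.2 h2) h1
      · rfl

theorem covers_snoc {m : ℕ} {xs : Fin m → Var} {x : Var} {Γ : Ctx A} :
    Covers (Fin.snoc xs x : Fin (m + 1) → Var) Γ ↔ Covers xs (without Γ x) := by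
  simp only [Covers, without, Multiset.mem_filter]
  refine forall_congr' fun q => ?_
  simp only [and_imp]
  refine forall_congr' fun _ => ⟨fun ⟨j, hj⟩ hx => ?_, fun h => ?_⟩
  · revert hj
    refine Fin.lastCases (fun hj => ?_) (fun i hi => ?_) j
    · exact absurd (by simpa using hj.symm) hx
    · exact ⟨i, by simpa using hi⟩
  · by_cases hx : q.1 = x
    · exact ⟨Fin.last m, by simp [hx]⟩
    · obtain ⟨j, hj⟩ := h hx
      exact ⟨j.castSucc, by simpa using hj⟩

theorem exists_fin_map_univ {X : Type*} (L : Multiset X) :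
    ∃ (n : ℕ) (f : Fin n → X), Finset.univ.val.map f = L := by
  refine Quot.inductionOn L fun l => ⟨l.length, l.get, ?_⟩
  rw [Fin.univ_val_map, List.ofFn_get]
  rfl

/-- The clauses of the semantics are the typing rules with sizes forgotten and the context spread
over the positions of `xs`. -/
theorem mem_interp_iff {t : Term} {m : ℕ} {xs : Fin m → Var} {a : Fin m → Multiset (D A)}
    {α : D A} : (a, α) ∈ interp A t m xs ↔
      ∃ n Γ, Derives t α (n, Γ) ∧ Covers xs Γ ∧ a = tuple xs Γ := by
  induction t generalizing m α with
  | var x =>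
    constructor
    · rintro ⟨j, rfl, hj, ha⟩
      exact ⟨1, {(xs j, α)}, rfl, by simp [Covers], ha.trans (tuple_singleton hj α).symm⟩
    · rintro ⟨n, Γ, h, hc, rfl⟩
      obtain ⟨rfl, rfl⟩ := Prod.mk.inj h
      obtain ⟨j, hj⟩ := hc (x, α) (by simp)
      obtain ⟨k, hk, hl⟩ := exists_isLast (xs := xs) j
      obtain rfl : xs k = x := hk.trans hj
      exact ⟨k, rfl, hl, tuple_singleton hl α⟩
  | lam x t ih =>
    constructor
    · rintro ⟨b, β, h, hmem⟩
      obtain rfl : α = D.arrow b β := h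
      obtain ⟨n, Γ, hΓ, hc, he⟩ := ih.1 hmem
      rw [tuple_snoc] at he
      obtain ⟨h1, h2⟩ := Fin.snoc_injective2 he
      exact ⟨n + 1, without Γ x, ⟨β, (n, Γ), hΓ, by rw [h2], rfl⟩, covers_snoc.1 hc, h1⟩
    · rintro ⟨n, Γ, ⟨β, ⟨k, Δ⟩, hΔ, rfl, h⟩, hc, rfl⟩
      obtain ⟨rfl, rfl⟩ := Prod.mk.inj h
      exact ⟨typesOf Δ x, β, rfl, ih.2 ⟨k, Δ, hΔ, covers_snoc.2 hc, (tuple_snoc xs x Δ).symm⟩⟩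
  | app v u ihv ihu =>
    constructor
    · rintro ⟨n, β, a₀, c, h, hv, hu⟩
      obtain ⟨k, Γ, hΓ, hc, rfl⟩ := ihv.1 hv
      choose l Δ hΔ hcΔ hcd using fun i => ihu.1 (hu i)
      have hsum : tuple xs (∑ i, Δ i) = ∑ i, c i := by
        rw [Finset.sum_congr rfl fun i _ => hcd i, tuple_sum]
      refine ⟨k + (∑ i, l i) + 1, Γ + ∑ i, Δ i, ⟨_, (k, Γ), (∑ i, l i, ∑ i, Δ i), hΓ,
        ⟨Finset.univ.val.map fun i => (β i, (l i, Δ i)), ?_, ?_, ?_⟩, ?_⟩, ?_, ?_⟩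
      · rw [Multiset.map_map]
        rfl
      · intro q hq
        obtain ⟨i, -, rfl⟩ := Multiset.mem_map.1 hq
        exact hΔ i
      · rw [Multiset.map_map]
        change ∑ i, (l i, Δ i) = _
        exact Prod.ext (by rw [Prod.fst_sum]) (by rw [Prod.snd_sum])
      · simp
      · refine covers_add.2 ⟨hc, fun q hq => ?_⟩
        obtain ⟨i, -, hi⟩ := Multiset.mem_sum.1 hq
        exact hcΔ i q hi
      · rw [tuple_add, hsum]
        exact h
    · rintro ⟨n, Γ, ⟨b, ⟨k, Δ⟩, r, hΔ, ⟨L, rfl, hL, rfl⟩, h⟩, hc, rfl⟩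
      obtain ⟨N, f, rfl⟩ := exists_fin_map_univ L
      have hs : (((Finset.univ.val.map f).map Prod.snd).sum).2 = ∑ i, (f i).2.2 := by
        rw [Multiset.map_map]
        exact Prod.snd_sum (s := Finset.univ) (f := fun i : Fin N => (f i).2)
      obtain ⟨rfl, rfl⟩ := Prod.mk.inj h
      simp only [Prod.snd_add, add_zero, covers_add, hs] at hc ⊢
      refine ⟨N, fun i => (f i).1, tuple xs Δ, fun i => tuple xs (f i).2.2, ?_, ?_, fun i => ?_⟩
      · rw [tuple_add]
        exact congrArg (tuple xs Δ + ·) (tuple_sum xs fun i => (f i).2.2)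
      · refine ihv.2 ⟨k, Δ, ?_, hc.1, rfl⟩
        rw [Multiset.map_map] at hΔ
        exact hΔ
      · refine ihu.2 ⟨(f i).2.1, (f i).2.2, hL _ (Multiset.mem_map_of_mem f (Finset.mem_univ i)),
          fun q hq => hc.2 q (Multiset.mem_sum.2 ⟨i, Finset.mem_univ i, hq⟩), rfl⟩

theorem mem_sem_iff {t : Term} (ht : t.Closed) {α : D A} :
    α ∈ sem A t ↔ ∃ n, Derives t α (n, 0) := by
  refine mem_interp_iff.trans ⟨fun ⟨n, Γ, h, _⟩ => ⟨n, ?_⟩, fun ⟨n, h⟩ => ⟨n, 0, h, ?_, ?_⟩⟩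
  · obtain rfl : Γ = 0 := h.eq_zero_of_closed ht
    exact h
  · intro q hq
    simp at hq
  · exact Subsingleton.elim _ _

/-! ## Substitutions -/

/-- The sum of the auxiliary sizes of the types in a context. -/
noncomputable def auxCtx (Γ : Ctx A) : ℕ := (Γ.map fun q => D.aux q.2).sum

theorem auxCtx_add (Γ Δ : Ctx A) : auxCtx (Γ + Δ) = auxCtx Γ + auxCtx Δ := by
  simp [auxCtx]

theorem auxCtx_eq (Γ : Ctx A) (x : Var) :
    auxCtx Γ = ((typesOf Γ x).map D.aux).sum + auxCtx (without Γ x) := by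
  conv_lhs => rw [← map_typesOf_add_without Γ x, auxCtx_add]
  rw [auxCtx, Multiset.map_map]
  rfl

theorem D.size_pos (α : D A) : 0 < size α := by
  refine D.induction (p := fun α => 0 < size α) (fun a => ?_) (fun m α _ _ => ?_) α
  · rw [size_atom]; exact Nat.one_pos
  · rw [size_arrow]; exact Nat.succ_pos _

/-- The substitution defined by a map on atoms. -/
noncomputable def D.bind (f : A → D A) : D A → D A :=
  QPF.Fix.rec (F := DF A) (fun x : DF A (D A) => x.elim f fun p => D.arrow p.1 p.2)

theorem D.bind_atom (f : A → D A) (a : A) : D.bind f (D.atom a) = f a :=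
  QPF.Fix.rec_eq (F := DF A) _ (.inl a)

theorem D.isSubstitution_bind (f : A → D A) : D.IsSubstitution (D.bind f) := fun m α =>
  QPF.Fix.rec_eq (F := DF A) _ (.inr (m, α))

/-- Points are classes of well-founded trees with finite arities and labels in `A ⊕ ℕ`, which has
the cardinality of `A` when `A` is infinite. -/
theorem D.mk_le [Infinite A] : Cardinal.mk (D A) ≤ Cardinal.mk A := by
  have h : Cardinal.mk (D A) ≤ Cardinal.mk (QPF.P (DF A)).W := Cardinal.mk_quotient_le
  have hfin : ∀ a : (QPF.P (DF A)).A, Finite ((QPF.P (DF A)).B a) := by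
    rintro (a | n)
    · exact inferInstanceAs (Finite PEmpty)
    · exact inferInstanceAs (Finite (ULift (Option (Fin n))))
  refine h.trans ((WType.cardinalMk_le_max_aleph0_of_finite (β := (QPF.P (DF A)).B)).trans ?_)
  refine max_le ?_ (Cardinal.aleph0_le_mk A)
  change Cardinal.mk (A ⊕ ℕ) ≤ _
  rw [Cardinal.mk_sum, Cardinal.lift_uzero, Cardinal.mk_nat, Cardinal.lift_aleph0,
    Cardinal.add_eq_left (Cardinal.aleph0_le_mk A) (Cardinal.aleph0_le_mk A)]

/-- A left inverse of an embedding of `D A` into `A` is a map from atoms onto all points. With it,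
any type in a derivation can be replaced by an atom above it, with no choice of fresh atoms. -/
theorem D.exists_substitution [Infinite A] :
    ∃ σ : D A → D A, D.IsSubstitution σ ∧ ∀ α, ∃ a, σ (D.atom a) = α := by
  obtain ⟨g⟩ : Nonempty (D A ↪ A) := D.mk_le
  have : Nonempty (D A) := ⟨D.atom (Classical.arbitrary A)⟩
  refine ⟨D.bind (Function.invFun g), D.isSubstitution_bind _, fun α => ⟨g α, ?_⟩⟩
  rw [D.bind_atom, Function.leftInverse_invFun g.injective]

theorem typesOf_map (σ : D A → D A) (Γ : Ctx A) (x : Var) :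
    typesOf (Γ.map (Prod.map id σ)) x = (typesOf Γ x).map σ := by
  simp only [typesOf, Multiset.filter_map, Multiset.map_map]
  rfl

theorem without_map (σ : D A → D A) (Γ : Ctx A) (x : Var) :
    without (Γ.map (Prod.map id σ)) x = (without Γ x).map (Prod.map id σ) := by
  simp only [without, Multiset.filter_map]
  rfl

theorem MSum.map_derives {σ : D A → D A} {t : Term}
    (h : ∀ {α : D A} {n Γ}, Derives t α (n, Γ) → Derives t (σ α) (n, Γ.map (Prod.map id σ)))
    {b : Multiset (D A)} {n : ℕ} {Γ : Ctx A} (hb : MSum (Derives t) b (n, Γ)) :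
    MSum (Derives t) (b.map σ) (n, Γ.map (Prod.map id σ)) := by
  induction b using Multiset.induction generalizing n Γ with
  | empty =>
    obtain ⟨rfl, rfl⟩ := Prod.mk.inj (MSum.zero_iff.1 hb)
    exact MSum.zero_iff.2 rfl
  | cons β b ih =>
    obtain ⟨⟨k, Δ⟩, ⟨l, E⟩, h1, h2, h3⟩ := MSum.cons_iff.1 hb
    obtain ⟨rfl, rfl⟩ := Prod.mk.inj h3
    rw [Multiset.map_cons]
    exact MSum.cons_iff.2 ⟨_, _, h h1, ih h2, by simp⟩

/-- The rules constrain types only through arrows and multisets, which substitutions respect. -/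
theorem Derives.map {σ : D A → D A} (hσ : D.IsSubstitution σ) {t : Term} {α : D A} {n : ℕ}
    {Γ : Ctx A} (h : Derives t α (n, Γ)) : Derives t (σ α) (n, Γ.map (Prod.map id σ)) := by
  induction t generalizing α n Γ with
  | var x =>
    obtain ⟨rfl, rfl⟩ := Prod.mk.inj h
    rfl
  | lam x t ih =>
    obtain ⟨β, ⟨k, Δ⟩, hΔ, rfl, h⟩ := h
    obtain ⟨rfl, rfl⟩ := Prod.mk.inj h
    exact ⟨_, _, ih hΔ, by rw [hσ, typesOf_map], by rw [without_map]⟩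
  | app v u ihv ihu =>
    obtain ⟨b, ⟨k, Δ⟩, ⟨l, E⟩, hΔ, hE, h⟩ := h
    obtain ⟨rfl, rfl⟩ := Prod.mk.inj h
    have hv := ihv hΔ
    rw [hσ] at hv
    exact ⟨_, _, _, hv, hE.map_derives ihu, by simp⟩

/-! ## Sizes of derivations of normal terms -/

theorem MSum.derives_le {t : Term}
    (h : ∀ {α : D A} {n Γ}, Derives t α (n, Γ) → n ≤ D.size α + auxCtx Γ)
    {b : Multiset (D A)} {n : ℕ} {Γ : Ctx A} (hb : MSum (Derives t) b (n, Γ)) :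
    n ≤ D.msize b + auxCtx Γ := by
  induction b using Multiset.induction generalizing n Γ with
  | empty =>
    obtain ⟨rfl, rfl⟩ := Prod.mk.inj (MSum.zero_iff.1 hb)
    exact Nat.zero_le _
  | cons β b ih =>
    obtain ⟨⟨k, Δ⟩, ⟨l, E⟩, h1, h2, h3⟩ := MSum.cons_iff.1 hb
    obtain ⟨rfl, rfl⟩ := Prod.mk.inj h3
    have h4 := h h1
    have h5 := ih h2
    simp only [D.msize, Multiset.map_cons, Multiset.sum_cons, auxCtx_add] at h5 ⊢
    omega

/-- The second bound serves terms headed by a variable. The type of the head pays in advance: `D.aux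
(D.arrow b α)` exceeds `D.aux α` by `D.msize b`, which covers the arguments, plus one for the
application rule. An abstraction moves the auxiliary sizes of the bound variable from the context
into `D.size` of the arrow. -/
theorem Derives.le_of_normal {t : Term} (ht : t.Normal) {α : D A} {n : ℕ} {Γ : Ctx A}
    (h : Derives t α (n, Γ)) :
    n ≤ D.size α + auxCtx Γ ∧ (¬ t.IsLam → n + D.aux α ≤ auxCtx Γ + 1) := by
  induction t generalizing α n Γ with
  | var x =>
    obtain ⟨rfl, rfl⟩ := Prod.mk.inj h
    have := D.size_pos α
    simp only [auxCtx, Multiset.map_singleton, Multiset.sum_singleton]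
    omega
  | lam x t ih =>
    refine ⟨?_, fun h => absurd ⟨x, t, rfl⟩ h⟩
    obtain ⟨β, ⟨k, Δ⟩, hΔ, rfl, h⟩ := h
    obtain ⟨rfl, rfl⟩ := Prod.mk.inj h
    have := (ih ht hΔ).1
    rw [auxCtx_eq Δ x] at this
    rw [D.size_arrow]
    dsimp only
    omega
  | app v u ihv ihu =>
    obtain ⟨b, ⟨k, Δ⟩, ⟨l, E⟩, hΔ, hE, h⟩ := h
    obtain ⟨rfl, rfl⟩ := Prod.mk.inj h
    have h1 := (ihv ht.2.1 hΔ).2 ht.1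
    have h2 := hE.derives_le fun h => (ihu ht.2.2 h).1
    have h3 := D.size_pos α
    rw [D.aux_arrow] at h1
    simp only [D.msize, Prod.mk_add_mk, add_zero, auxCtx_add] at h2 ⊢
    omega

/-! ## Principal derivations of normal terms -/

theorem MSum.exists_principal {σ : D A → D A} {t : Term}
    (h : ∀ {α : D A} {n Γ}, Derives t α (n, Γ) → ∃ α' Γ', Derives t α' (n, Γ') ∧ σ α' = α ∧
      Γ'.map (Prod.map id σ) = Γ ∧ n = D.size α' + auxCtx Γ')
    {b : Multiset (D A)} {n : ℕ} {Γ : Ctx A} (hb : MSum (Derives t) b (n, Γ)) :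
    ∃ b' Γ', MSum (Derives t) b' (n, Γ') ∧ b'.map σ = b ∧
      Γ'.map (Prod.map id σ) = Γ ∧ n = D.msize b' + auxCtx Γ' := by
  induction b using Multiset.induction generalizing n Γ with
  | empty =>
    obtain ⟨rfl, rfl⟩ := Prod.mk.inj (MSum.zero_iff.1 hb)
    exact ⟨0, 0, MSum.zero_iff.2 rfl, rfl, rfl, rfl⟩
  | cons β b ih =>
    obtain ⟨⟨k, Δ⟩, ⟨l, E⟩, h1, h2, h3⟩ := MSum.cons_iff.1 hb
    obtain ⟨rfl, rfl⟩ := Prod.mk.inj h3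
    obtain ⟨β', Δ', h4, rfl, rfl, h5⟩ := h h1
    obtain ⟨b', E', h6, rfl, rfl, h7⟩ := ih h2
    refine ⟨β' ::ₘ b', Δ' + E', MSum.cons_iff.2 ⟨_, _, h4, h6, rfl⟩, by simp, by simp, ?_⟩
    simp only [D.msize, Multiset.map_cons, Multiset.sum_cons, auxCtx_add] at h7 ⊢
    omega

/-- For a term headed by a variable the lifted type may be prescribed freely, since it is inherited
from the type assumed for the head; the second bound of `Derives.le_of_normal` is then an equality.
This freedom allows the principal types of the arguments to be imposed on the function. -/
theorem Derives.exists_principal {σ : D A → D A} (hσ : D.IsSubstitution σ)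
    (hσ' : ∀ α, ∃ a, σ (D.atom a) = α) {t : Term} (ht : t.Normal) {α : D A} {n : ℕ} {Γ : Ctx A}
    (h : Derives t α (n, Γ)) :
    (∃ α' Γ', Derives t α' (n, Γ') ∧ σ α' = α ∧
      Γ'.map (Prod.map id σ) = Γ ∧ n = D.size α' + auxCtx Γ') ∧
    (¬ t.IsLam → ∀ α', σ α' = α → ∃ Γ', Derives t α' (n, Γ') ∧
      Γ'.map (Prod.map id σ) = Γ ∧ n + D.aux α' = auxCtx Γ' + 1) := by
  -- Prescribing an atom, of size 1 and auxiliary size 0, turns the equality for neutral terms into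
  -- the general one.
  have of_neutral : ∀ {t : Term} {α : D A} {n : ℕ} {Γ : Ctx A},
      (∀ α', σ α' = α → ∃ Γ', Derives t α' (n, Γ') ∧
        Γ'.map (Prod.map id σ) = Γ ∧ n + D.aux α' = auxCtx Γ' + 1) →
      ∃ α' Γ', Derives t α' (n, Γ') ∧ σ α' = α ∧
        Γ'.map (Prod.map id σ) = Γ ∧ n = D.size α' + auxCtx Γ' := by
    intro t α n Γ h
    obtain ⟨a, ha⟩ := hσ' α
    obtain ⟨Γ', h1, h2, h3⟩ := h _ ha
    rw [D.aux_atom] at h3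
    exact ⟨_, Γ', h1, ha, h2, by rw [D.size_atom]; omega⟩
  induction t generalizing α n Γ with
  | var x =>
    obtain ⟨rfl, rfl⟩ := Prod.mk.inj h
    suffices key : _ from ⟨of_neutral key, fun _ => key⟩
    rintro α' rfl
    exact ⟨{(x, α')}, rfl, rfl, by simp [auxCtx, add_comm]⟩
  | lam x t ih =>
    refine ⟨?_, fun h => absurd ⟨x, t, rfl⟩ h⟩
    obtain ⟨β, ⟨k, Δ⟩, hΔ, rfl, h⟩ := h
    obtain ⟨rfl, rfl⟩ := Prod.mk.inj h
    obtain ⟨β', Δ', h1, rfl, rfl, h2⟩ := (ih ht hΔ).1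
    refine ⟨_, _, ⟨β', _, h1, rfl, rfl⟩, by rw [hσ, typesOf_map], by rw [without_map], ?_⟩
    rw [auxCtx_eq Δ' x] at h2
    rw [D.size_arrow, h2]
    ring
  | app v u ihv ihu =>
    suffices key : _ from ⟨of_neutral key, fun _ => key⟩
    rintro α' rfl
    obtain ⟨b, ⟨k, Δ⟩, ⟨l, E⟩, hΔ, hE, h⟩ := h
    obtain ⟨rfl, rfl⟩ := Prod.mk.inj h
    obtain ⟨b', E', h1, rfl, rfl, h2⟩ :=
      hE.exists_principal (σ := σ) fun hβ => (ihu ht.2.2 hβ).1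
    -- The function is not an abstraction, so its type can be lifted to the arrow whose source is
    -- the lifted multiset of the arguments.
    obtain ⟨Δ', h3, rfl, h4⟩ := (ihv ht.2.1 hΔ).2 ht.1 (D.arrow b' α') (hσ _ _)
    refine ⟨Δ' + E', ⟨b', _, _, h3, h1, by simp⟩, by simp, ?_⟩
    rw [D.aux_arrow] at h4
    simp only [D.msize, Prod.mk_add_mk, auxCtx_add] at h2 ⊢
    omega

/-- Function and argument are lifted independently, so the two lifted multisets need not agree. They
agree after `σ`, which is therefore a unifier. -/
theorem Derives.exists_principal_app {σ : D A → D A} (hσ : D.IsSubstitution σ)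
    (hσ' : ∀ α, ∃ a, σ (D.atom a) = α) {u v : Term} (hu : u.Normal) (hv : v.Normal)
    {α : D A} {n : ℕ} (h : Derives (.app v u) α (n, 0)) :
    ∃ b' α' b'' k l, Derives v (D.arrow b' α') (k, 0) ∧ MSum (Derives u) b'' (l, 0) ∧
      b'.map σ = b''.map σ ∧ σ α' = α ∧ n = D.size (D.arrow b' α') + D.msize b'' + 1 := by
  obtain ⟨b, ⟨k, Δ⟩, ⟨l, E⟩, hΔ, hE, h⟩ := h
  obtain ⟨rfl, h0⟩ := Prod.mk.inj h
  obtain ⟨rfl, rfl⟩ : Δ = 0 ∧ E = 0 := by simpa using h0.symm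
  obtain ⟨b'', E', h1, rfl, h2, h3⟩ :=
    hE.exists_principal (σ := σ) fun hβ => (hβ.exists_principal hσ hσ' hu).1
  obtain ⟨γ, Δ', h4, h5, h6, h7⟩ := (hΔ.exists_principal hσ hσ' hv).1
  rw [Multiset.map_eq_zero] at h2 h6
  subst h2 h6
  -- The principal type of an abstraction is an arrow, never an atom. Any other normal `v` is
  -- excluded: in the empty context the neutral bound leaves room for one rule or one unit of
  -- `D.aux`, but an arrow type needs both.
  by_cases hlam : v.IsLam
  · obtain ⟨x, t, rfl⟩ := hlam
    obtain ⟨β, q, -, rfl, -⟩ := id h4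
    rw [hσ] at h5
    obtain ⟨h8, rfl⟩ := D.arrow_inj h5
    refine ⟨_, _, b'', k, l, h4, h1, h8, rfl, ?_⟩
    simp only [auxCtx, Multiset.map_zero, Multiset.sum_zero, add_zero] at h3 h7
    rw [← h3, ← h7]
    rfl
  · have h8 := (hΔ.le_of_normal hv).2 hlam
    have h9 := hΔ.fst_pos
    rw [D.aux_arrow] at h8
    simp only [auxCtx, Multiset.map_zero, Multiset.sum_zero] at h8 h9
    omega

/-! ## Typing of closures and states -/

/-- `c.HasType P α n`: the closure `c` has the type `α`, with a derivation with `n` rules in which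
the types of the variables out of the domains of the environments satisfy `P`. -/
def Closure.HasType (P : D A → Prop) : Closure → D A → ℕ → Prop
  | .mk t dom e, α, n => ∃ k Γ m, Derives t α (k, Γ) ∧
      MSum (fun (q : Var × D A) l =>
        if h : q.1 ∈ dom then (e ⟨q.1, h⟩).HasType P q.2 l else P q.2 ∧ l = 0) Γ m ∧ n = k + m

/-- The typing of variables in an environment. -/
def EnvType (P : D A → Prop) (dom : Finset Var) (e : {x // x ∈ dom} → Closure) (q : Var × D A)
    (l : ℕ) : Prop :=
  if h : q.1 ∈ dom then (e ⟨q.1, h⟩).HasType P q.2 l else P q.2 ∧ l = 0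

variable {P : D A → Prop} {dom : Finset Var} {e : {x // x ∈ dom} → Closure}

theorem Closure.hasType_mk {t : Term} {α : D A} {n : ℕ} :
    (Closure.mk t dom e).HasType P α n ↔
      ∃ k Γ m, Derives t α (k, Γ) ∧ MSum (EnvType P dom e) Γ m ∧ n = k + m := by
  rw [Closure.HasType]
  rfl

/-- Typing a closure several times amounts to typing its term several times and then its environment
once, for the sum of the contexts. -/
theorem MSum.hasType_iff {t : Term} {b : Multiset (D A)} {n : ℕ} :
    MSum ((Closure.mk t dom e).HasType P) b n ↔
      ∃ k Γ m, MSum (Derives t) b (k, Γ) ∧ MSum (EnvType P dom e) Γ m ∧ n = k + m := by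
  induction b using Multiset.induction generalizing n with
  | empty =>
    simp only [MSum.zero_iff]
    constructor
    · rintro rfl
      exact ⟨0, 0, 0, rfl, MSum.zero_iff.2 rfl, rfl⟩
    · rintro ⟨k, Γ, m, h, hm, rfl⟩
      obtain ⟨rfl, rfl⟩ := Prod.mk.inj h
      exact (zero_add m).trans (MSum.zero_iff.1 hm)
  | cons β b ih =>
    simp only [MSum.cons_iff, ih, Closure.hasType_mk]
    constructor
    · rintro ⟨_, _, ⟨k, Γ, m, h1, h2, rfl⟩, ⟨k', Γ', m', h3, h4, rfl⟩, rfl⟩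
      exact ⟨k + k', Γ + Γ', m + m', ⟨_, _, h1, h3, rfl⟩, MSum.add_iff.2 ⟨_, _, h2, h4, rfl⟩,
        add_add_add_comm _ _ _ _⟩
    · rintro ⟨k, Γ, m, ⟨⟨k', Γ'⟩, ⟨k'', Γ''⟩, h1, h2, h⟩, hm, rfl⟩
      obtain ⟨rfl, rfl⟩ := Prod.mk.inj h
      obtain ⟨m', m'', h3, h4, rfl⟩ := MSum.add_iff.1 hm
      exact ⟨_, _, ⟨_, _, _, h1, h3, rfl⟩, ⟨_, _, _, h2, h4, rfl⟩, add_add_add_comm _ _ _ _⟩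

theorem Closure.hasType_var {x : Var} {α : D A} {n : ℕ} :
    (Closure.mk (.var x) dom e).HasType P α n ↔ ∃ m, EnvType P dom e (x, α) m ∧ n = m + 1 := by
  rw [Closure.hasType_mk]
  constructor
  · rintro ⟨k, Γ, m, h, hm, rfl⟩
    obtain ⟨rfl, rfl⟩ := Prod.mk.inj h
    exact ⟨m, MSum.singleton_iff.1 hm, add_comm _ _⟩
  · rintro ⟨m, h, rfl⟩
    exact ⟨1, {(x, α)}, m, rfl, MSum.singleton_iff.2 h, add_comm _ _⟩

theorem Closure.hasType_app {v u : Term} {α : D A} {n : ℕ} :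
    (Closure.mk (.app v u) dom e).HasType P α n ↔
      ∃ b k l, (Closure.mk v dom e).HasType P (D.arrow b α) k ∧
        MSum ((Closure.mk u dom e).HasType P) b l ∧ n = k + l + 1 := by
  simp only [MSum.hasType_iff, Closure.hasType_mk]
  constructor
  · rintro ⟨k, Γ, m, ⟨b, ⟨k', Γ'⟩, ⟨k'', Γ''⟩, h1, h2, h⟩, hm, rfl⟩
    obtain ⟨rfl, rfl⟩ := Prod.mk.inj h
    obtain ⟨m', m'', h3, h4, rfl⟩ := MSum.add_iff.1 (by simpa using hm)
    exact ⟨b, _, _, ⟨_, _, _, h1, h3, rfl⟩, ⟨_, _, _, h2, h4, rfl⟩,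
      by simp only [Prod.mk_add_mk]; omega⟩
  · rintro ⟨b, _, _, ⟨k, Γ, m, h1, h2, rfl⟩, ⟨k', Γ', m', h3, h4, rfl⟩, rfl⟩
    exact ⟨k + k' + 1, Γ + Γ', m + m', ⟨b, _, _, h1, h3, by simp⟩,
      MSum.add_iff.2 ⟨_, _, h2, h4, rfl⟩, by omega⟩

theorem Closure.hasType_lam {x : Var} {t : Term} {γ : D A} {n : ℕ} :
    (Closure.mk (.lam x t) dom e).HasType P γ n ↔
      ∃ α k Γ m, Derives t α (k, Γ) ∧ γ = D.arrow (typesOf Γ x) α ∧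
        MSum (EnvType P dom e) (without Γ x) m ∧ n = k + m + 1 := by
  rw [Closure.hasType_mk]
  constructor
  · rintro ⟨k, Γ, m, ⟨α, ⟨k', Γ'⟩, h1, rfl, h⟩, hm, rfl⟩
    obtain ⟨rfl, rfl⟩ := Prod.mk.inj h
    exact ⟨α, k', Γ', m, h1, rfl, hm, add_right_comm _ _ _⟩
  · rintro ⟨α, k, Γ, m, h, rfl, hm, rfl⟩
    exact ⟨_, _, m, ⟨α, _, h, rfl, rfl⟩, hm, add_right_comm _ _ _⟩

theorem MSum.envType_iff {x : Var} {R : D A → ℕ → Prop} {Γ : Ctx A}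
    {e' : {x // x ∈ dom} → Closure} {n : ℕ} (hx : ∀ α m, EnvType P dom e' (x, α) m ↔ R α m) :
    MSum (EnvType P dom e') Γ n ↔
      ∃ l m, MSum R (typesOf Γ x) l ∧ MSum (EnvType P dom e') (without Γ x) m ∧ n = l + m := by
  conv_lhs => rw [← map_typesOf_add_without Γ x]
  rw [MSum.add_iff]
  simp only [MSum.map_iff, MSum.congr fun α _ m => hx α m]

/-- Binding `x` to `c` erases the abstraction rule, and the typings of `c` as an argument become
those of the uses of `x`. No freshness is needed, because the new binding overrides any old one. -/
theorem Closure.hasType_extend {x : Var} {t : Term} {c : Closure} {α : D A} {n : ℕ} :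
    (Closure.extend t x c dom e).HasType P α n ↔
      ∃ b k l, (Closure.mk (.lam x t) dom e).HasType P (D.arrow b α) (k + 1) ∧
        MSum (c.HasType P) b l ∧ n = k + l := by
  have hx : ∀ β m, EnvType P (insert x dom) (fun y => if h : y.1 = x then c else
      e ⟨y.1, Finset.mem_of_mem_insert_of_ne y.2 h⟩) (x, β) m ↔ c.HasType P β m := by
    simp [EnvType]
  have hy : ∀ (Γ : Ctx A) m, MSum (EnvType P (insert x dom) (fun y => if h : y.1 = x then c else
      e ⟨y.1, Finset.mem_of_mem_insert_of_ne y.2 h⟩)) (without Γ x) m ↔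
      MSum (EnvType P dom e) (without Γ x) m := by
    refine fun Γ m => MSum.congr fun q hq l => ?_
    have : q.1 ≠ x := (Multiset.mem_filter.1 hq).2
    simp [EnvType, this]
  simp only [Closure.extend, Closure.hasType_mk (t := t), Closure.hasType_lam]
  constructor
  · rintro ⟨k, Γ, _, h1, h, rfl⟩
    obtain ⟨l, m, h2, h3, rfl⟩ := (MSum.envType_iff hx).1 h
    exact ⟨_, k + m, l, ⟨α, k, Γ, m, h1, rfl, (hy Γ m).1 h3, rfl⟩, h2, by omega⟩
  · rintro ⟨b, k, l, ⟨β, k', Γ, m, h1, h, h3, h4⟩, h2, rfl⟩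
    obtain ⟨rfl, rfl⟩ := D.arrow_inj h
    exact ⟨k', Γ, _, h1, (MSum.envType_iff hx).2 ⟨l, m, h2, (hy Γ m).2 h3, rfl⟩, by omega⟩

/-- This is the cost of entering an abstraction on an empty stack. The variable convention enters
through `hx`: if `x` were in the domain, its occurrences in the body would be looked up in the
environment. -/
theorem Closure.hasType_lam_iff_body {x : Var} (hx : x ∉ dom) {t : Term} {α : D A} {n : ℕ} :
    (Closure.mk t dom e).HasType P α n ↔ ∃ b, (∀ β ∈ b, P β) ∧
      (Closure.mk (.lam x t) dom e).HasType P (D.arrow b α) (n + 1) := by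
  have hx' : ∀ β m, EnvType P dom e (x, β) m ↔ P β ∧ m = 0 := by
    simp [EnvType, hx]
  simp only [Closure.hasType_mk (t := t), Closure.hasType_lam]
  constructor
  · rintro ⟨k, Γ, _, h1, h, rfl⟩
    obtain ⟨l, m, h2, h3, rfl⟩ := (MSum.envType_iff hx').1 h
    obtain ⟨h4, rfl⟩ := MSum.null_iff.1 h2
    exact ⟨_, h4, α, k, Γ, m, h1, rfl, h3, by omega⟩
  · rintro ⟨b, h2, β, k, Γ, m, h1, h, h3, h4⟩
    obtain ⟨rfl, rfl⟩ := D.arrow_inj h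
    exact ⟨k, Γ, _, h1,
      (MSum.envType_iff hx').2 ⟨0, m, MSum.null_iff.2 ⟨h2, rfl⟩, h3, rfl⟩, by omega⟩

/-- `StackType P π γ α n`: applied to the closures in `π`, the type `γ` gives the type `α`. -/
def StackType (P : D A → Prop) : List Closure → D A → D A → ℕ → Prop
  | [], γ, α, n => γ = α ∧ n = 0
  | c :: π, γ, α, n => ∃ b γ' k l, γ = D.arrow b γ' ∧ MSum (c.HasType P) b k ∧
      StackType P π γ' α l ∧ n = k + l

/-- `s.HasType P α n`: the state `s` has the type `α`, with a derivation with `n` rules. -/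
def State.HasType (P : D A → Prop) (s : State) (α : D A) (n : ℕ) : Prop :=
  ∃ γ k l, s.top.HasType P γ k ∧ StackType P s.rest γ α l ∧ n = k + l

/-- Subject reduction and expansion with an exact count: each transition consumes one rule, namely
variable, abstraction or application according to the term on top. Exactness comes from typing a
closure separately for each use. -/
theorem State.hasType_iff_of_step {s s' : State} (h : s.step = some s') {α : D A} {n : ℕ} :
    s.HasType P α n ↔ ∃ m, s'.HasType P α m ∧ n = m + 1 := by
  obtain ⟨⟨t, dom, e⟩, π⟩ := s
  cases t with
  | var x =>
    by_cases hx : x ∈ dom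
    · obtain rfl : State.mk (e ⟨x, hx⟩) π = s' := by simpa [State.step, hx] using h
      simp only [State.HasType, Closure.hasType_var, EnvType, hx, dif_pos]
      constructor
      · rintro ⟨γ, _, l, ⟨m, h1, rfl⟩, h2, rfl⟩
        exact ⟨m + l, ⟨γ, m, l, h1, h2, rfl⟩, add_right_comm _ _ _⟩
      · rintro ⟨_, ⟨γ, m, l, h1, h2, rfl⟩, rfl⟩
        exact ⟨γ, _, l, ⟨m, h1, rfl⟩, h2, add_right_comm _ _ _⟩
    · simp [State.step, hx] at h
  | lam x t =>
    cases π with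
    | nil => simp [State.step] at h
    | cons c π =>
      obtain rfl : State.mk (Closure.extend t x c dom e) π = s' := by simpa [State.step] using h
      simp only [State.HasType, Closure.hasType_extend, StackType]
      constructor
      · rintro ⟨_, k, _, h1, ⟨b, γ, l, m, rfl, h2, h3, rfl⟩, rfl⟩
        obtain ⟨k, rfl⟩ : ∃ k', k = k' + 1 := by
          obtain ⟨_, _, _, _, _, _, _, rfl⟩ := Closure.hasType_lam.1 h1
          exact ⟨_, rfl⟩
        exact ⟨_, ⟨γ, _, m, ⟨b, k, l, h1, h2, rfl⟩, h3, rfl⟩, by omega⟩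
      · rintro ⟨_, ⟨γ, _, m, ⟨b, k, l, h1, h2, rfl⟩, h3, rfl⟩, rfl⟩
        exact ⟨_, _, _, h1, ⟨b, γ, l, m, rfl, h2, h3, rfl⟩, by omega⟩
  | app v u =>
    obtain rfl : State.mk (.mk v dom e) (.mk u dom e :: π) = s' := by
      simpa [State.step] using h
    simp only [State.HasType, Closure.hasType_app, StackType]
    constructor
    · rintro ⟨γ, _, m, ⟨b, k, l, h1, h2, rfl⟩, h3, rfl⟩
      exact ⟨_, ⟨_, k, _, h1, ⟨b, γ, l, m, rfl, h2, h3, rfl⟩, rfl⟩, by omega⟩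
    · rintro ⟨_, ⟨_, k, _, h1, ⟨b, γ, l, m, rfl, h2, h3, rfl⟩, rfl⟩, rfl⟩
      exact ⟨γ, _, m, ⟨b, k, l, h1, h2, rfl⟩, h3, by omega⟩

theorem State.hasType_ofTerm {t : Term} (ht : t.Closed) {α : D A} {n : ℕ} :
    (State.ofTerm t).HasType P α n ↔ Derives t α (n, 0) := by
  simp only [State.HasType, State.ofTerm, Closure.ofTerm, StackType, Closure.hasType_mk]
  constructor
  · rintro ⟨_, _, _, ⟨k, Γ, m, h1, h2, rfl⟩, ⟨rfl, rfl⟩, rfl⟩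
    obtain rfl : Γ = 0 := h1.eq_zero_of_closed ht
    obtain rfl := MSum.zero_iff.1 h2
    exact h1
  · intro h
    exact ⟨α, n, 0, ⟨n, 0, 0, h, MSum.zero_iff.2 rfl, rfl⟩, ⟨rfl, rfl⟩, rfl⟩

/-! ## Well-formed states -/

/-- Every variable is bound at most once in the terms of `c`, and not in the domain of the
environment. -/
def Closure.WF : Closure → Prop
  | .mk t dom e => t.binders.Nodup ∧ (∀ x ∈ t.binders, x ∉ dom) ∧ ∀ x, (e x).WF

/-- All the closures of `s` are well-formed. -/
def State.WF (s : State) : Prop := s.top.WF ∧ ∀ c ∈ s.rest, c.WF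

/-- The condition concerns each closure separately, so it survives the duplication of closures. A
variable entering a domain is no longer bound in the remaining term, as it was bound only once. -/
theorem State.WF.step {s s' : State} (hs : s.WF) (h : s.step = some s') : s'.WF := by
  obtain ⟨⟨t, dom, e⟩, π⟩ := s
  obtain ⟨hc, hπ⟩ := hs
  rw [Closure.WF] at hc
  obtain ⟨h1, h2, h3⟩ := hc
  cases t with
  | var x =>
    by_cases hx : x ∈ dom
    · obtain rfl : State.mk (e ⟨x, hx⟩) π = s' := by simpa [State.step, hx] using h
      exact ⟨h3 _, hπ⟩
    · simp [State.step, hx] at h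
  | lam x t =>
    cases π with
    | nil => simp [State.step] at h
    | cons c π =>
      obtain rfl : State.mk (Closure.extend t x c dom e) π = s' := by simpa [State.step] using h
      refine ⟨?_, fun c' hc' => hπ c' (List.mem_cons_of_mem _ hc')⟩
      rw [Term.binders, List.nodup_cons] at h1
      simp only [Closure.extend, Closure.WF]
      refine ⟨h1.2, fun y hy => ?_, fun y => ?_⟩
      · rw [Finset.mem_insert, not_or]
        exact ⟨fun h => h1.1 (h ▸ hy), h2 y (List.mem_cons_of_mem _ hy)⟩
      · split_ifs
        · exact hπ c List.mem_cons_self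
        · exact h3 _
  | app v u =>
    obtain rfl : State.mk (.mk v dom e) (.mk u dom e :: π) = s' := by
      simpa [State.step] using h
    rw [Term.binders, List.nodup_append'] at h1
    have hu : (Closure.mk u dom e).WF := by
      rw [Closure.WF]
      exact ⟨h1.2.1, fun x hx => h2 x (List.mem_append_right _ hx), h3⟩
    refine ⟨?_, List.forall_mem_cons.2 ⟨hu, hπ⟩⟩
    rw [Closure.WF]
    exact ⟨h1.1, fun x hx => h2 x (List.mem_append_left _ hx), h3⟩

theorem Closure.WF.body {x : Var} {t : Term} (h : (Closure.mk (.lam x t) dom e).WF) :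
    x ∉ dom ∧ (Closure.mk t dom e).WF := by
  rw [Closure.WF] at h ⊢
  rw [Term.binders, List.nodup_cons] at h
  exact ⟨h.2.1 x List.mem_cons_self, h.1.2, fun y hy => h.2.1 y (List.mem_cons_of_mem _ hy), h.2.2⟩

theorem State.WF.ofTerm {t : Term} (h : t.RespectsVC) : (State.ofTerm t).WF := by
  refine ⟨?_, by simp [State.ofTerm]⟩
  simp only [State.ofTerm, Closure.ofTerm, Closure.WF]
  exact ⟨h, by simp, fun x => absurd x.2 (Finset.notMem_empty x.1)⟩

/-- A state without transition is a variable out of the domain of its environment, or an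
abstraction with an empty stack. -/
theorem State.step_eq_none {s : State} (h : s.step = none) :
    (∃ x dom e π, x ∉ dom ∧ s = ⟨.mk (.var x) dom e, π⟩) ∨
      ∃ x t dom e, s = ⟨.mk (.lam x t) dom e, []⟩ := by
  obtain ⟨⟨t, dom, e⟩, π⟩ := s
  cases t with
  | var x =>
    refine Or.inl ⟨x, dom, e, π, fun hx => ?_, rfl⟩
    simp [State.step, hx] at h
  | lam x t =>
    cases π with
    | nil => exact Or.inr ⟨x, t, dom, e, rfl⟩
    | cons c π => simp [State.step] at h
  | app v u => simp [State.step] at h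

/-! ## Executions -/

theorem haltsIn_succ_iff {K : Type} {step : K → Option K} {k k' : K} (h : step k = some k')
    {n : ℕ} :
    HaltsIn step n k ↔ ∃ m, n = m + 1 ∧ HaltsIn step m k' := by
  cases n with
  | zero => simp [HaltsIn, h]
  | succ n => simp [HaltsIn, h]

theorem haltsIn_zero_iff {K : Type} {step : K → Option K} {k : K} (h : step k = none) {n : ℕ} :
    HaltsIn step n k ↔ n = 0 := by
  cases n with
  | zero => simp [HaltsIn, h]
  | succ n => simp [HaltsIn, h]

theorem haltsIn_map {K L : Type} {step : K → Option K} {step' : L → Option L} {f : K → L}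
    (h : ∀ k, step' (f k) = (step k).map f) {n : ℕ} {k : K} :
    HaltsIn step' n (f k) ↔ HaltsIn step n k := by
  induction n generalizing k with
  | zero => simp [HaltsIn, h]
  | succ n ih => simp [HaltsIn, h, ih]

theorem haltsIn_headStep_lam {n : ℕ} {y : Var} {k : Conf} :
    HaltsIn headStep n (.lam y k) ↔ HaltsIn headStep n k :=
  haltsIn_map fun k => by rw [headStep]

theorem haltsIn_betaStep_lam {n : ℕ} {y : Var} {k : Conf} :
    HaltsIn betaStep n (.lam y k) ↔ HaltsIn betaStep n k :=
  haltsIn_map fun k => by rw [betaStep]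

theorem haltsIn_betaStep_head {n : ℕ} {h : HeadTerm} :
    HaltsIn betaStep n (.head h) ↔ HaltsIn betaStepHead n h :=
  haltsIn_map fun h => by rw [betaStep]

/-- The argument starts only once the head term on its left is blocked, so the two runs are
concatenated. -/
theorem haltsIn_appConf {n : ℕ} {h : HeadTerm} {k : Conf} :
    HaltsIn betaStepHead n (.appConf h k) ↔
      ∃ i j, HaltsIn betaStepHead i h ∧ HaltsIn betaStep j k ∧ n = i + j := by
  induction n generalizing h k with
  | zero =>
    simp only [HaltsIn, betaStepHead]
    cases hh : betaStepHead h with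
    | some h' =>
      simp only [reduceCtorEq, false_iff, not_exists]
      rintro i j ⟨h1, -, h2⟩
      obtain ⟨rfl, rfl⟩ : i = 0 ∧ j = 0 := by omega
      simp [HaltsIn, hh] at h1
    | none =>
      simp only [haltsIn_zero_iff hh, Option.map_eq_none_iff]
      constructor
      · exact fun h => ⟨0, 0, rfl, h, rfl⟩
      · rintro ⟨_, j, rfl, h, hj⟩
        obtain rfl : j = 0 := by omega
        exact h
  | succ n ih =>
    simp only [HaltsIn, betaStepHead]
    cases hh : betaStepHead h with
    | some h' =>
      simp only [haltsIn_succ_iff hh, Option.some.injEq, exists_eq_left', ih]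
      constructor
      · rintro ⟨i, j, h1, h2, rfl⟩
        exact ⟨i + 1, j, ⟨i, rfl, h1⟩, h2, by omega⟩
      · rintro ⟨_, j, ⟨i, rfl, h1⟩, h2, h⟩
        exact ⟨i, j, h1, h2, by omega⟩
    | none =>
      simp only [haltsIn_zero_iff hh, Option.map_eq_some_iff]
      constructor
      · rintro ⟨_, ⟨k', hk, rfl⟩, hn⟩
        obtain ⟨i, j, h1, h2, rfl⟩ := ih.1 hn
        rw [haltsIn_zero_iff hh] at h1
        subst h1
        exact ⟨0, j + 1, rfl, ⟨k', hk, h2⟩, by omega⟩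
      · rintro ⟨_, j, rfl, h2, hj⟩
        obtain rfl : j = n + 1 := by omega
        obtain ⟨k', hk, h2⟩ := h2
        exact ⟨_, ⟨k', hk, rfl⟩, ih.2 ⟨0, n, (haltsIn_zero_iff hh).2 rfl, h2, by omega⟩⟩

/-! ## The head machine -/

theorem headStep_of_step {s s' : State} (h : s.step = some s') :
    headStep (.state s) = some (.state s') := by
  simp only [headStep, h]

theorem headStep_var {x : Var} (hx : x ∉ dom) {π : List Closure} :
    headStep (.state ⟨.mk (.var x) dom e, π⟩) =
      some (.head (π.foldl (fun h c => .appTerm h c.toTerm) (.var x))) := by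
  simp [headStep, State.step, hx]

theorem headStep_lam {x : Var} {t : Term} :
    headStep (.state ⟨.mk (.lam x t) dom e, []⟩) = some (.lam x (.state ⟨.mk t dom e, []⟩)) := by
  simp [headStep, State.step]

/-- The size of the derivation decreases at each step. It is only an upper bound, because a
derivation may also type arguments of the head variable, which this machine does not run. -/
theorem exists_haltsIn_headStep {s : State} (hs : s.WF) {α : D A} {n : ℕ}
    (h : s.HasType (fun _ => True) α n) : ∃ m ≤ n, HaltsIn headStep m (.state s) := by
  induction n generalizing s α with
  | zero =>
    obtain ⟨γ, k, l, h1, -, h2⟩ := h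
    obtain ⟨⟨t, dom, e⟩, π⟩ := s
    obtain ⟨i, Γ, j, h3, -, rfl⟩ := Closure.hasType_mk.1 h1
    have := h3.fst_pos
    simp only at this
    omega
  | succ n ih =>
    cases hstep : s.step with
    | some s' =>
      obtain ⟨m, hm, h'⟩ := (State.hasType_iff_of_step hstep).1 h
      obtain rfl : n = m := by omega
      obtain ⟨m, hm, hm'⟩ := ih (hs.step hstep) hm
      exact ⟨m + 1, by omega, _, headStep_of_step hstep, hm'⟩
    | none =>
      rcases State.step_eq_none hstep with ⟨x, dom, e, π, hx, rfl⟩ | ⟨x, t, dom, e, rfl⟩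
      · exact ⟨1, by omega, _, headStep_var hx, by rw [HaltsIn, headStep]⟩
      · obtain ⟨γ, k, _, h1, ⟨rfl, rfl⟩, rfl⟩ := h
        obtain ⟨hx, hwf⟩ := hs.1.body
        obtain ⟨β, _, _, _, _, rfl, -⟩ := Closure.hasType_lam.1 h1
        obtain ⟨m, hm, hm'⟩ := ih (s := ⟨.mk t dom e, []⟩) ⟨hwf, by simp⟩
          ⟨β, n, 0, (Closure.hasType_lam_iff_body hx).2 ⟨_, fun _ _ => trivial, h1⟩,
            ⟨rfl, rfl⟩, rfl⟩
        exact ⟨m + 1, by omega, _, headStep_lam, haltsIn_headStep_lam.2 hm'⟩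

/-- Each closure is typed by the empty multiset, at no cost. -/
theorem exists_stackType_null (P : D A → Prop) (π : List Closure) (α : D A) :
    ∃ γ, StackType P π γ α 0 := by
  induction π with
  | nil => exact ⟨α, rfl, rfl⟩
  | cons c π ih =>
    obtain ⟨γ, h⟩ := ih
    exact ⟨_, 0, γ, 0, 0, rfl, MSum.zero_iff.2 rfl, h, rfl⟩

/-- The run is read backwards. Its last step reaches a head variable, typed by one rule with
arguments typed for free. -/
theorem exists_hasType_of_haltsIn_headStep [Nonempty A] {s : State} (hs : s.WF) {n : ℕ}
    (h : HaltsIn headStep n (.state s)) : ∃ α : D A, s.HasType (fun _ => True) α n := by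
  induction n generalizing s with
  | zero =>
    cases hstep : s.step with
    | some s' => simp [HaltsIn, headStep_of_step hstep] at h
    | none =>
      rcases State.step_eq_none hstep with ⟨x, dom, e, π, hx, rfl⟩ | ⟨x, t, dom, e, rfl⟩
      · simp [HaltsIn, headStep_var hx] at h
      · simp [HaltsIn, headStep_lam] at h
  | succ n ih =>
    cases hstep : s.step with
    | some s' =>
      obtain ⟨m, hm, h'⟩ := (haltsIn_succ_iff (headStep_of_step hstep)).1 h
      obtain rfl : n = m := by omega
      obtain ⟨α, hα⟩ := ih (hs.step hstep) h'
      exact ⟨α, (State.hasType_iff_of_step hstep).2 ⟨n, hα, rfl⟩⟩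
    | none =>
      rcases State.step_eq_none hstep with ⟨x, dom, e, π, hx, rfl⟩ | ⟨x, t, dom, e, rfl⟩
      · obtain ⟨m, hm, h'⟩ := (haltsIn_succ_iff (headStep_var hx)).1 h
        rw [haltsIn_zero_iff (by rw [headStep])] at h'
        obtain ⟨γ, hγ⟩ := exists_stackType_null (fun _ => True) π
          (D.atom (Classical.arbitrary A))
        exact ⟨_, γ, 1, 0, Closure.hasType_var.2 ⟨0, by simp [EnvType, hx], rfl⟩, hγ, by omega⟩
      · obtain ⟨m, hm, h'⟩ := (haltsIn_succ_iff headStep_lam).1 h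
        obtain rfl : n = m := by omega
        obtain ⟨hx, hwf⟩ := hs.1.body
        obtain ⟨_, γ, k, _, h1, ⟨rfl, rfl⟩, rfl⟩ :=
          ih ⟨hwf, by simp⟩ (haltsIn_headStep_lam.1 h')
        obtain ⟨b, -, hb⟩ := (Closure.hasType_lam_iff_body hx).1 h1
        exact ⟨_, _, _, 0, hb, ⟨rfl, rfl⟩, rfl⟩

/-! ## The normalizing machine -/

theorem betaStep_of_step {s s' : State} (h : s.step = some s') :
    betaStep (.state s) = some (.state s') := by
  simp only [betaStep, h]

theorem betaStep_var {x : Var} (hx : x ∉ dom) {π : List Closure} :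
    betaStep (.state ⟨.mk (.var x) dom e, π⟩) =
      some (.head (π.foldl (fun h c => .appConf h (.state ⟨c, []⟩)) (.var x))) := by
  simp [betaStep, State.step, hx]

theorem betaStep_lam {x : Var} {t : Term} :
    betaStep (.state ⟨.mk (.lam x t) dom e, []⟩) = some (.lam x (.state ⟨.mk t dom e, []⟩)) := by
  simp [betaStep, State.step]

theorem D.isEx_arrow {m : Multiset (D A)} {α : D A} :
    IsEx (arrow m α) ↔ (∀ β ∈ m, IsExBar β) ∧ IsEx α := by
  constructor
  · intro h
    generalize hγ : arrow m α = γ at h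
    cases h with
    | atom a => exact absurd hγ.symm (atom_ne_arrow a m α)
    | arrow m' α' h1 h2 =>
      obtain ⟨rfl, rfl⟩ := arrow_inj hγ
      exact ⟨h1, h2⟩
  · exact fun h => .arrow m α h.1 h.2

theorem D.isExBar_arrow {m : Multiset (D A)} {α : D A} :
    IsExBar (arrow m α) ↔ m ≠ 0 ∧ (∀ β ∈ m, IsEx β) ∧ IsExBar α := by
  constructor
  · intro h
    generalize hγ : arrow m α = γ at h
    cases h with
    | atom a => exact absurd hγ.symm (atom_ne_arrow a m α)
    | arrow m' α' h1 h2 h3 =>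
      obtain ⟨rfl, rfl⟩ := arrow_inj hγ
      exact ⟨h1, h2, h3⟩
  · exact fun h => .arrow m α h.1 h.2.1 h.2.2

theorem State.hasType_nil {c : Closure} {α : D A} {n : ℕ} :
    (State.mk c []).HasType P α n ↔ c.HasType P α n := by
  constructor
  · rintro ⟨γ, k, _, h, ⟨rfl, rfl⟩, rfl⟩
    exact h
  · exact fun h => ⟨α, n, 0, h, ⟨rfl, rfl⟩, rfl⟩

/-- The hypothesis `ih` is the induction hypothesis of `exists_haltsIn_betaStep`, applied to each
argument of the head variable. -/
theorem exists_haltsIn_foldl {N : ℕ} (ih : ∀ {s : State}, s.WF → ∀ {α : D A}, D.IsEx α →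
      ∀ {n : ℕ}, n ≤ N → s.HasType D.IsExBar α n → ∃ m ≤ n, HaltsIn betaStep m (.state s))
    {π : List Closure} (hπ : ∀ c ∈ π, c.WF) {γ α : D A} (hγ : D.IsExBar γ) {n : ℕ} (hn : n ≤ N)
    (h : StackType D.IsExBar π γ α n) {H : HeadTerm} {j : ℕ} (hH : HaltsIn betaStepHead j H) :
    ∃ m ≤ j + n, HaltsIn betaStepHead m
      (π.foldl (fun h c => .appConf h (.state ⟨c, []⟩)) H) := by
  induction π generalizing γ n H j with
  | nil => exact ⟨j, by omega, hH⟩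
  | cons c π ihπ =>
    obtain ⟨b, γ', k, l, rfl, hk, hl, rfl⟩ := h
    obtain ⟨hb, hb', hγ'⟩ := D.isExBar_arrow.1 hγ
    -- Each argument is run once, so one of its typings bounds the run. The others only enlarge the
    -- derivation.
    obtain ⟨β, hβ⟩ := Multiset.exists_mem_of_ne_zero hb
    obtain ⟨b, rfl⟩ := Multiset.exists_cons_of_mem hβ
    obtain ⟨q, r, hq, -, rfl⟩ := MSum.cons_iff.1 hk
    obtain ⟨i, hi, hi'⟩ := ih (s := ⟨c, []⟩) ⟨hπ c List.mem_cons_self, by simp⟩ (hb' β hβ)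
      (by omega) (State.hasType_nil.2 hq)
    obtain ⟨m, hm, hm'⟩ := ihπ (fun c hc => hπ c (List.mem_cons_of_mem _ hc)) hγ' (by omega) hl
      (haltsIn_appConf.2 ⟨j, i, hH, hi', rfl⟩)
    exact ⟨m, by omega, hm'⟩

/-- The two conditions on types are preserved together. Under an abstraction, the source of a type
in `D.IsEx` provides types in `D.IsExBar` for the new free variable. At a head variable, a type in
`D.IsExBar` provides at least one type for each argument, all in `D.IsEx`. -/
theorem exists_haltsIn_betaStep {s : State} (hs : s.WF) {α : D A} (hα : D.IsEx α) {n : ℕ}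
    (h : s.HasType D.IsExBar α n) : ∃ m ≤ n, HaltsIn betaStep m (.state s) := by
  induction n using Nat.strong_induction_on generalizing s α with
  | _ n ih =>
    cases hstep : s.step with
    | some s' =>
      obtain ⟨m, hm, rfl⟩ := (State.hasType_iff_of_step hstep).1 h
      obtain ⟨m, hm, hm'⟩ := ih m (by omega) (hs.step hstep) hα hm
      exact ⟨m + 1, by omega, _, betaStep_of_step hstep, hm'⟩
    | none =>
      rcases State.step_eq_none hstep with ⟨x, dom, e, π, hx, rfl⟩ | ⟨x, t, dom, e, rfl⟩
      · obtain ⟨γ, _, l, h1, h2, rfl⟩ := h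
        obtain ⟨m, h3, rfl⟩ := Closure.hasType_var.1 h1
        obtain ⟨hγ, rfl⟩ : D.IsExBar γ ∧ m = 0 := by simpa [EnvType, hx] using h3
        obtain ⟨m, hm, hm'⟩ := exists_haltsIn_foldl (N := l)
          (fun hs _ hα _ hn h => ih _ (by omega) hs hα h) hs.2 hγ le_rfl h2 (H := .var x) (j := 0)
          (by rw [HaltsIn, betaStepHead])
        exact ⟨m + 1, by omega, _, betaStep_var hx, haltsIn_betaStep_head.2 hm'⟩
      · have h1 := State.hasType_nil.1 h
        obtain ⟨hx, hwf⟩ := hs.1.body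
        obtain ⟨β, k, Γ, m, _, rfl, _, rfl⟩ := Closure.hasType_lam.1 h1
        obtain ⟨hb, hβ⟩ := D.isEx_arrow.1 hα
        obtain ⟨i, hi, hi'⟩ := ih (k + m) (by omega) (s := ⟨.mk t dom e, []⟩) ⟨hwf, by simp⟩ hβ
          (State.hasType_nil.2 ((Closure.hasType_lam_iff_body hx).2 ⟨_, hb, h1⟩))
        exact ⟨i + 1, by omega, _, betaStep_lam, haltsIn_betaStep_lam.2 hi'⟩

/-- Each argument receives exactly one type, obtained from its own run. The singletons keep the head
type in `D.IsExBar` and make the count exact. -/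
theorem exists_stackType_of_haltsIn_foldl {N : ℕ} (ih : ∀ {s : State}, s.WF → ∀ {n : ℕ}, n ≤ N →
      HaltsIn betaStep n (.state s) → ∃ α : D A, D.IsEx α ∧ s.HasType D.IsExBar α n)
    {π : List Closure} (hπ : ∀ c ∈ π, c.WF) (a : A) {n : ℕ} (hn : n ≤ N) {H : HeadTerm}
    (h : HaltsIn betaStepHead n (π.foldl (fun h c => .appConf h (.state ⟨c, []⟩)) H)) :
    ∃ γ j l, HaltsIn betaStepHead j H ∧ D.IsExBar γ ∧
      StackType D.IsExBar π γ (D.atom a) l ∧ n = j + l := by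
  induction π generalizing H with
  | nil => exact ⟨D.atom a, n, 0, h, .atom a, ⟨rfl, rfl⟩, rfl⟩
  | cons c π ihπ =>
    obtain ⟨γ, _, l, hj, hγ, hl, rfl⟩ := ihπ (fun c hc => hπ c (List.mem_cons_of_mem _ hc)) h
    obtain ⟨j, i, hj', hi, rfl⟩ := haltsIn_appConf.1 hj
    obtain ⟨β, hβ, hi'⟩ := ih (s := ⟨c, []⟩) ⟨hπ c List.mem_cons_self, by simp⟩ (by omega) hi
    exact ⟨D.arrow {β} γ, j, i + l, hj', D.isExBar_arrow.2 ⟨by simp, by simpa using hβ, hγ⟩,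
      ⟨_, γ, i, l, rfl, MSum.singleton_iff.2 (State.hasType_nil.1 hi'), hl, rfl⟩, by omega⟩

theorem exists_hasType_of_haltsIn_betaStep [Nonempty A] {s : State} (hs : s.WF) {n : ℕ}
    (h : HaltsIn betaStep n (.state s)) :
    ∃ α : D A, D.IsEx α ∧ s.HasType D.IsExBar α n := by
  induction n using Nat.strong_induction_on generalizing s with
  | _ n ih =>
    cases hstep : s.step with
    | some s' =>
      obtain ⟨m, rfl, h'⟩ := (haltsIn_succ_iff (betaStep_of_step hstep)).1 h
      obtain ⟨α, hα, hα'⟩ := ih m (by omega) (hs.step hstep) h'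
      exact ⟨α, hα, (State.hasType_iff_of_step hstep).2 ⟨m, hα', rfl⟩⟩
    | none =>
      rcases State.step_eq_none hstep with ⟨x, dom, e, π, hx, rfl⟩ | ⟨x, t, dom, e, rfl⟩
      · obtain ⟨m, rfl, h'⟩ := (haltsIn_succ_iff (betaStep_var hx)).1 h
        obtain ⟨γ, j, l, hj, hγ, hl, rfl⟩ := exists_stackType_of_haltsIn_foldl
          (fun hs _ hn h => ih _ (by omega) hs h) hs.2 (Classical.arbitrary A) le_rfl
          (haltsIn_betaStep_head.1 h')
        rw [haltsIn_zero_iff (by rw [betaStepHead])] at hj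
        exact ⟨_, .atom _, γ, 1, l,
          Closure.hasType_var.2 ⟨0, by simpa [EnvType, hx] using hγ, rfl⟩, hl, by omega⟩
      · obtain ⟨m, rfl, h'⟩ := (haltsIn_succ_iff betaStep_lam).1 h
        obtain ⟨hx, hwf⟩ := hs.1.body
        obtain ⟨α, hα, h1⟩ := ih m (by omega) (s := ⟨.mk t dom e, []⟩) ⟨hwf, by simp⟩
          (haltsIn_betaStep_lam.1 h')
        obtain ⟨b, hb, hb'⟩ := (Closure.hasType_lam_iff_body hx).1 (State.hasType_nil.1 h1)
        exact ⟨_, D.isEx_arrow.2 ⟨hb, hα⟩, State.hasType_nil.2 hb'⟩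

/-! ## Execution times and unification -/

theorem Term.AlphaUnder.exists_mem_fv {l : List (Var × Var)} {t u : Term} (h : AlphaUnder l t u)
    {x : Var} (hx : x ∈ t.fv) : ∃ y ∈ u.fv, AlphaVar l x y := by
  induction t generalizing l u with
  | var z =>
    cases u with
    | var y =>
      obtain rfl : x = z := by simpa [fv] using hx
      exact ⟨y, by simp [fv], h⟩
    | lam y u => exact h.elim
    | app v u => exact h.elim
  | lam z t ih =>
    cases u with
    | var y => exact h.elim
    | lam z' u =>
      obtain ⟨hz, hx⟩ := Finset.mem_erase.1 hx
      obtain ⟨y, hy, ⟨h', -⟩ | ⟨-, hz', h'⟩⟩ := ih h hx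
      · exact absurd h' hz
      · exact ⟨y, Finset.mem_erase.2 ⟨hz', hy⟩, h'⟩
    | app v u => exact h.elim
  | app v t ihv iht =>
    cases u with
    | var y => exact h.elim
    | lam y u => exact h.elim
    | app v' u =>
      rcases Finset.mem_union.1 hx with hx | hx
      · obtain ⟨y, hy, h'⟩ := ihv h.1 hx
        exact ⟨y, Finset.mem_union_left _ hy, h'⟩
      · obtain ⟨y, hy, h'⟩ := iht h.2 hx
        exact ⟨y, Finset.mem_union_right _ hy, h'⟩

theorem Term.AlphaEq.closed {t u : Term} (h : t.AlphaEq u) (hu : u.Closed) : t.Closed := by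
  refine Finset.eq_empty_of_forall_notMem fun x hx => ?_
  obtain ⟨y, hy, -⟩ := AlphaUnder.exists_mem_fv h hx
  simp [show u.fv = ∅ from hu] at hy

/-- The execution time is given by unification, for a step function whose execution time is the
minimal size of the derivations of the types satisfying `Q`. -/
theorem runLength_eq_iInf [Infinite A] {u v : Term} (hu : u.Closed) (hu' : u.Normal)
    (hv : v.Closed) (hv' : v.Normal) {step : Conf → Option Conf} {k : Conf} {Q : D A → Prop}
    (h₁ : ∀ α n, Q α → Derives (.app v u) α (n, 0) → ∃ m ≤ n, HaltsIn step m k)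
    (h₂ : ∀ n, HaltsIn step n k → ∃ α, Q α ∧ Derives (.app v u) α (n, 0)) :
    runLength step k = ⨅ p ∈ {p : (Multiset (D A) × D A) × Multiset (D A) |
      D.arrow p.1.1 p.1.2 ∈ sem A v ∧ (∀ β ∈ p.2, β ∈ sem A u) ∧
        ∃ σ : D A → D A, D.IsSubstitution σ ∧ p.1.1.map σ = p.2.map σ ∧ Q (σ p.1.2)},
      (weight p : ℕ∞) := by
  refine le_antisymm (le_iInf₂ ?_) (le_iInf₂ ?_)
  · rintro ⟨⟨b, α⟩, c⟩ ⟨hb, hc, σ, hσ, hbc, hQ⟩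
    obtain ⟨n, hn⟩ := (mem_sem_iff hv).1 hb
    obtain ⟨l, hl⟩ : ∃ l, MSum (Derives u) c (l, 0) := by
      clear hbc hQ hb hn
      induction c using Multiset.induction with
      | empty => exact ⟨0, MSum.zero_iff.2 rfl⟩
      | cons β c ih =>
        obtain ⟨l, hl⟩ := ih fun β hβ => hc β (Multiset.mem_cons_of_mem hβ)
        obtain ⟨m, hm⟩ := (mem_sem_iff hu).1 (hc β (Multiset.mem_cons_self β c))
        exact ⟨m + l, MSum.cons_iff.2 ⟨_, _, hm, hl, rfl⟩⟩
    have hn' := (hn.le_of_normal hv').1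
    have hl' := hl.derives_le fun h => (h.le_of_normal hu').1
    -- After `σ`, the source of the type of `v` is the multiset of types of `u`, so the application
    -- rule joins the two derivations, adding one rule.
    have hv := hn.map hσ
    rw [hσ, show b.map σ = c.map σ from hbc] at hv
    obtain ⟨m, hm, hm'⟩ := h₁ (σ α) (n + l + 1) hQ
      ⟨_, _, _, hv, hl.map_derives fun h => h.map hσ, by simp⟩
    refine (iInf₂_le m hm').trans (Nat.cast_le.2 ?_)
    simp only [auxCtx, Multiset.map_zero, Multiset.sum_zero] at hn' hl'
    simp only [weight]
    omega
  · intro n hn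
    obtain ⟨α, hQ, hα⟩ := h₂ n hn
    -- This same `σ` is the unifier of the pair found below, and it sends the lifted result type to
    -- `α`, which satisfies `Q`.
    obtain ⟨σ, hσ, hσ'⟩ := D.exists_substitution (A := A)
    obtain ⟨b, β, c, m, l, h3, h4, h5, rfl, rfl⟩ := hα.exists_principal_app hσ hσ' hu' hv'
    refine iInf₂_le (α := ℕ∞) ((b, β), c) ⟨(mem_sem_iff hv).2 ⟨m, h3⟩, ?_, σ, hσ, h5, hQ⟩
    obtain ⟨L, rfl, hL, -⟩ := h4
    intro δ hδ
    obtain ⟨q, hq, rfl⟩ := Multiset.mem_map.1 hδ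
    refine (mem_sem_iff hu).2 ⟨q.2.1, ?_⟩
    have := hL q hq
    rw [← this.eq_zero_of_closed hu]
    exact this

end Krivine

theorem mainTheorem1 {A : Type*} [Infinite A] (u v w : Krivine.Term)
    (hu : u.Closed) (hu' : u.Normal) (hv : v.Closed) (hv' : v.Normal)
    (hw : w.AlphaEq (.app v u)) (hw' : w.RespectsVC) :
    Krivine.lHead (.state (.ofTerm w)) =
        ⨅ p ∈ Krivine.unif (Krivine.sem A v) (Krivine.sem A u), (Krivine.weight p : ℕ∞) ∧
      Krivine.lBeta (.state (.ofTerm w)) =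
        ⨅ p ∈ Krivine.unifEx (Krivine.sem A v) (Krivine.sem A u), (Krivine.weight p : ℕ∞) := by
  have hcl : w.Closed := hw.closed (by
    simp [Krivine.Term.Closed, Krivine.Term.fv, show v.fv = ∅ from hv, show u.fv = ∅ from hu])
  have hwf := Krivine.State.WF.ofTerm hw'
  -- A closed term has no free assumption, so the condition `P` on free variables is vacuous
  -- initially and both machines start from the same derivations.
  have hα : ∀ {P : Krivine.D A → Prop} {α : Krivine.D A} {n : ℕ},
      (Krivine.State.ofTerm w).HasType P α n ↔ Krivine.Derives (.app v u) α (n, 0) :=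
    (Krivine.State.hasType_ofTerm hcl).trans (Krivine.derives_congr_alphaEq hw)
  constructor
  · refine (Krivine.runLength_eq_iInf hu hu' hv hv' (Q := fun _ : Krivine.D A => True)
      (fun α n _ h => Krivine.exists_haltsIn_headStep hwf (hα.2 h)) fun n h => ?_).trans ?_
    · obtain ⟨α, h⟩ := Krivine.exists_hasType_of_haltsIn_headStep (A := A) hwf h
      exact ⟨α, trivial, hα.1 h⟩
    · simp only [Krivine.unif, and_true]
  · refine Krivine.runLength_eq_iInf hu hu' hv hv' (Q := Krivine.D.IsEx)
      (fun α n hQ h => Krivine.exists_haltsIn_betaStep hwf hQ (hα.2 h)) fun n h => ?_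
    obtain ⟨α, hQ, h⟩ := Krivine.exists_hasType_of_haltsIn_betaStep (A := A) hwf h
    exact ⟨α, hQ, hα.1 h⟩
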